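/- Let $G=(V,E,\omega)$ be a finite connected undirected graph without self loops or multiple edges, with node set $V=\{1,\dots,N\}$ and symmetric weights $\omega_{ij}=\omega_{ji}>0$ on edges; $N(i)$ denotes the set of neighbours of $i$, and sums over $(i,j)\in E$ run over ordered pairs of adjacent nodes. Let $\mathcal P(G)=\{\rho\in\mathbb R^N:\rho_i\ge 0,\ \sum_i\rho_i=1\}$, $\theta_{ij}(\rho)=\frac{\rho_i+\rho_j}{2}$, and $(\nabla_G S)_{ij}=\sqrt{\omega_{ij}}\,(S_i-S_j)$ for $S\in\mathbb R^N$. Let $\Sigma\in\mathbb R^N$ be a given potential on the nodes, $W$ a standard Wiener process on a probability space $(\Omega,\mathbb P)$, $\delta>0$, and $W^\delta$ the piecewise linear (Wong–Zakai) interpolation of $W$ on the grid $t_k=k\delta$, with derivative $\dot W^\delta(t)=\frac{W(t_{k+1})-W(t_k)}{\delta}$ for $t\in[t_k,t_{k+1})$. For $\rho^a,\rho^b\in\mathcal P(G)$ and a fixed sample point of $\Omega$, let $C_F(\rho^a,\rho^b)$ be the set of pairs $(\rho,m)$ with $\rho\in H^1([0,1];\mathcal P(G))$, $m\in L^2([0,1];\mathcal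 S^{N\times N})$ ($\mathcal S^{N\times N}$ being the skew-symmetric matrices), $\rho(0)=\rho^a$, $\rho(1)=\rho^b$ and, for every $i$, $$d\rho_i(t)+\sum_{j\in N(i)}\sqrt{\omega_{ij}}\,m_{ij}\,dt+\sum_{j\in N(i)}\omega_{ij}(\Sigma_j-\Sigma_i)\,\theta_{ij}(\rho)\,dW^\delta(t)=0 .$$ Let $$\mathcal A(\rho,m)=\int_0^1\frac14\sum_{(i,j)\in E}L(\theta_{ij}(\rho),m_{ij})\,dt,$$ where $L(x,y)=y^2/x$ if $x>0$, $L(0,0)=0$, and $L(x,y)=\infty$ otherwise. Theorem. For all $\rho^a,\rho^b\in\mathcal P(G)$ and every sample point of $\Omega$, the minimum of $\mathcal A$ over $C_F(\rho^a,\rho^b)$ is attained and finite, and $$\min_{(\rho,m)\in C_F(\rho^a,\rho^b)}\mathcal A(\rho,m)=\sup_{S}\big\{\langle S(1),\rho^b\rangle-\langle S(0),\rho^a\rangle\big\},$$ where the supremum is over all $S\in H^1([0,1];\mathbb R^N)$ such that for almost every $t\in[0,1]$ $$\sup_{\rho\in\mathcal P(G)}\Big\{\langle\dot S,\rho\rangle+\frac14\sum_{(i,j)\in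 E}(\nabla_G S)_{ij}^2\,\theta_{ij}(\rho)+\frac12\sum_{(i,j)\in E}(\nabla_G\Sigma)_{ij}(\nabla_G S)_{ij}\,\theta_{ij}(\rho)\,\dot W^\delta(t)\Big\}=0 .$$ -/

import Mathlib

open MeasureTheory ProbabilityTheory Set
open scoped NNReal ENNReal

noncomputable section

namespace GraphOT

/-! ### The Wong--Zakai approximation -/

/-- The piecewise linear interpolation `W^δ` of a path `w` on the grid `t_k = k δ`. -/
def wongZakai (w : ℝ≥0 → ℝ) (δ : ℝ≥0) (t : ℝ) : ℝ :=
  w (⌊t / δ⌋₊ * δ) +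
    (t - ⌊t / δ⌋₊ * δ) / δ * (w ((⌊t / δ⌋₊ + 1) * δ) - w (⌊t / δ⌋₊ * δ))

/-- The time derivative of `W^δ`: `(w (t_{k+1}) - w (t_k)) / δ` for `t ∈ [t_k, t_{k+1})`. -/
def wongZakaiDeriv (w : ℝ≥0 → ℝ) (δ : ℝ≥0) (t : ℝ) : ℝ :=
  (w ((⌊t / δ⌋₊ + 1) * δ) - w (⌊t / δ⌋₊ * δ)) / δ

/-- `wongZakaiDeriv` is the derivative of `wongZakai` away from the grid points. -/
theorem hasDerivAt_wongZakai (w : ℝ≥0 → ℝ) {δ : ℝ≥0} (hδ : 0 < δ) (k : ℕ) {t : ℝ}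
    (ht : t ∈ Ioo (k * δ : ℝ) ((k + 1) * δ)) :
    HasDerivAt (wongZakai w δ) (wongZakaiDeriv w δ t) t := by
  have hδ' : (0 : ℝ) < δ := hδ
  have key : ∀ s ∈ Ioo (k * δ : ℝ) ((k + 1) * δ), ⌊s / (δ : ℝ)⌋₊ = k := by
    intro s hs
    have h0 : 0 ≤ s / (δ : ℝ) := div_nonneg (le_trans (by positivity) hs.1.le) hδ'.le
    rw [Nat.floor_eq_iff h0, le_div_iff₀ hδ', div_lt_iff₀ hδ']
    exact ⟨hs.1.le, hs.2⟩
  have h1 : HasDerivAt (fun s : ℝ => w (k * δ) +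
      (s - k * δ) / δ * (w ((k + 1) * δ) - w (k * δ)))
      (1 / (δ : ℝ) * (w ((k + 1) * δ) - w (k * δ))) t :=
    ((((hasDerivAt_id t).sub_const _).div_const _).mul_const _).const_add _
  have h2 : wongZakaiDeriv w δ t = 1 / (δ : ℝ) * (w ((k + 1) * δ) - w (k * δ)) := by
    simp only [wongZakaiDeriv, key t ht]
    ring
  rw [h2]
  refine h1.congr_of_eventuallyEq ?_
  filter_upwards [Ioo_mem_nhds ht.1 ht.2] with s hs
  simp only [wongZakai, key s hs]

/-! ### The Sobolev space on the unit interval -/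

/-- `f` is (the continuous representative of) an `H¹` function on `[0,1]`, with weak derivative
`g ∈ L²(0,1)`. -/
def HasH1Deriv (f g : ℝ → ℝ) : Prop :=
  MemLp g 2 (volume.restrict (Icc (0 : ℝ) 1)) ∧
    ∀ t ∈ Icc (0 : ℝ) 1, f t = f 0 + ∫ s in (0 : ℝ)..t, g s

/-- `f ∈ H¹([0,1])`. -/
def MemH1 (f : ℝ → ℝ) : Prop := ∃ g, HasH1Deriv f g

/-! ### Calculus on a weighted graph -/

/-- The probability weight `θ_ij(ρ) = (ρ_i + ρ_j) / 2`. -/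
def theta {V : Type*} (ρ : V → ℝ) (i j : V) : ℝ := (ρ i + ρ j) / 2

/-- The discrete gradient `(∇_G S)_ij = √ω_ij (S_i - S_j)`. -/
def grad {V : Type*} (ω : V → V → ℝ) (S : V → ℝ) (i j : V) : ℝ :=
  √(ω i j) * (S i - S j)

/-- The function `L(x,y)`: `y² / x` if `x > 0`, `0` if `x = y = 0`, and `∞` otherwise. -/
def edgeCost (x y : ℝ) : ℝ≥0∞ :=
  open Classical in
  if 0 < x then ENNReal.ofReal (y ^ 2 / x) else if x = 0 ∧ y = 0 then 0 else ∞

section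

variable {V : Type*} [Fintype V] (G : SimpleGraph V) [DecidableRel G.Adj]

/-- The action `𝒜(ρ,m) = ∫₀¹ ¼ ∑_{(i,j) ∈ E} L(θ_ij(ρ), m_ij) dt`; the sum runs over ordered
pairs of adjacent nodes. -/
def action (ρ : ℝ → V → ℝ) (m : ℝ → V → V → ℝ) : ℝ≥0∞ :=
  ∫⁻ t in Icc (0 : ℝ) 1,
    4⁻¹ * ∑ i, ∑ j ∈ G.neighborFinset i, edgeCost (theta (ρ t) i j) (m t i j)

/-- The inner product `⟨u,v⟩_θ(ρ) = ½ ∑_{(i,j) ∈ E} u_ij v_ij θ_ij(ρ)`, the sum running over ordered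
pairs of adjacent nodes. -/
def edgeInner (ρ : V → ℝ) (u v : V → V → ℝ) : ℝ :=
  1 / 2 * ∑ i, ∑ j ∈ G.neighborFinset i, u i j * v i j * theta ρ i j

/-- The feasible set `C_F(ρ^a,ρ^b)`: the pairs `ρ ∈ H¹([0,1]; 𝒫(G))`, `m ∈ L²([0,1]; 𝒮)` with `m`
skew-symmetric, `ρ(0) = ρ^a`, `ρ(1) = ρ^b` and
`dρ_i + ∑_{j ∈ N(i)} √ω_ij m_ij dt + ∑_{j ∈ N(i)} ω_ij (Σ_j - Σ_i) θ_ij(ρ) dW^δ = 0`. Here `σ`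
stands for `Σ` and `dw` for the derivative of the driving path. -/
structure Feasible (ω : V → V → ℝ) (σ : V → ℝ) (dw : ℝ → ℝ) (ρa ρb : V → ℝ)
    (ρ : ℝ → V → ℝ) (m : ℝ → V → V → ℝ) : Prop where
  memH1 : ∀ i, MemH1 fun t => ρ t i
  mem_simplex : ∀ t ∈ Icc (0 : ℝ) 1, ρ t ∈ stdSimplex ℝ V
  memL2 : ∀ i j, MemLp (fun t => m t i j) 2 (volume.restrict (Icc (0 : ℝ) 1))
  skew : ∀ᵐ t ∂volume.restrict (Icc (0 : ℝ) 1), ∀ i j, m t i j = -m t j i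
  init : ρ 0 = ρa
  final : ρ 1 = ρb
  continuity_eq : ∀ i, ∀ t ∈ Icc (0 : ℝ) 1,
    ρ t i - ρ 0 i
      + (∫ s in (0 : ℝ)..t, ∑ j ∈ G.neighborFinset i, √(ω i j) * m s i j)
      + (∫ s in (0 : ℝ)..t,
          (∑ j ∈ G.neighborFinset i, ω i j * (σ j - σ i) * theta (ρ s) i j) * dw s) = 0

/-- The Hamilton--Jacobi expression
`⟨p,ρ⟩ + ¼ ∑_{ij} v_ij² θ_ij(ρ) + ½ ∑_{ij} (∇_G Σ)_ij (∇_G S)_ij θ_ij(ρ) a` with `v = ∇_G S`, where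
`p` stands for the time derivative of `S` and `a` for that of the driving path. -/
def hamiltonJacobi (ω : V → V → ℝ) (σ : V → ℝ) (a : ℝ) (S p ρ : V → ℝ) : ℝ :=
  (∑ i, p i * ρ i) + 1 / 2 * edgeInner G ρ (grad ω S) (grad ω S)
    + edgeInner G ρ (grad ω σ) (grad ω S) * a

/-- `S ∈ H¹([0,1]; ℝ^V)`, with weak derivative `S'`, is admissible in the dual problem: for almost
every `t`, the supremum over `ρ ∈ 𝒫(G)` of the Hamilton--Jacobi expression is `0`. -/
structure DualAdmissible (ω : V → V → ℝ) (σ : V → ℝ) (dw : ℝ → ℝ) (S S' : ℝ → V → ℝ) : Prop where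
  hasH1Deriv : ∀ i, HasH1Deriv (fun t => S t i) (fun t => S' t i)
  sup_eq_zero : ∀ᵐ t ∂volume.restrict (Icc (0 : ℝ) 1),
    IsLUB ((fun ρ => hamiltonJacobi G ω σ (dw t) (S t) (S' t) ρ) '' stdSimplex ℝ V) 0

end

end GraphOT

end

namespace GraphOT

/-! For a fixed sample point the noise enters only as a bounded function `a` on [0,1]. The problem
is then convex with a linear constraint: pairs (ρ, m) live in the Hilbert space of L² functions with
values in `PairSpace V`, the action is convex and lower semicontinuous, and the time-integrated
continuity equation reads T f = y with T bounded and linear, because the drift is linear in ρ.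

Weak duality comes from integrating d/dt ⟨S, ρ⟩ and completing the square on each edge
(`sum_mul_sub_outflow`, `ofReal_le_edgeCost`).

For the converse, let D be the dual supremum. By Hahn–Banach, if every multiplier φ admits a point
of the epigraph with r + φ(T f - y) ≤ D, then (D + ε, y) lies in the closure of the image of the
epigraph for every ε > 0. Since sublevel sets are closed, convex and bounded, the approximate
solutions can be chosen to converge, giving an exact solution of cost at most D
(`exists_mem_epigraph_of_dual_le`). This yields attainment and the absence of a gap at once, without
an interior-point condition.

Given φ, Riesz representation and integration by parts turn it into a potential S
(`repr_functional_constraint`). Take the flux -θ(ρ) ∇S with ρ(t) maximising the Hamilton–Jacobi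
expression, and let μ(t) be that maximum. The Lagrangian equals ⟨S(1), ρb⟩ - ⟨S(0), ρa⟩ - ∫ μ, which
is the dual value of the admissible potential S - ∫₀ᵗ μ, hence at most D (`exists_lagrangian_le`).

Finiteness needs an explicit curve, since ρa and ρb may vanish at some nodes;
`exists_mem_actionEpigraph` builds one. -/

/-! ### Convex duality in a Hilbert space -/

open Filter Topology in
/-- A decreasing sequence of nonempty closed convex bounded subsets of a Hilbert space has a common
point. -/
theorem nonempty_iInter_of_convex {H : Type*} [NormedAddCommGroup H] [InnerProductSpace ℝ H]
    [CompleteSpace H] (K : ℕ → Set H) (hanti : Antitone K) (hne : ∀ n, (K n).Nonempty)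
    (hcl : ∀ n, IsClosed (K n)) (hconv : ∀ n, Convex ℝ (K n))
    (hbdd : ∃ R, ∀ x ∈ K 0, ‖x‖ ≤ R) : (⋂ n, K n).Nonempty := by
  have hmin : ∀ n, ∃ v ∈ K n, ∀ w ∈ K n, ‖v‖ ≤ ‖w‖ := by
    intro n
    obtain ⟨v, hv, h⟩ := exists_norm_eq_iInf_of_complete_convex (hne n) (hcl n).isComplete
      (hconv n) 0
    refine ⟨v, hv, fun w hw => ?_⟩
    rw [zero_sub, norm_neg] at h
    rw [h]
    refine (ciInf_le ⟨0, ?_⟩ (⟨w, hw⟩ : K n)).trans (by simp)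
    rintro _ ⟨x, rfl⟩
    exact norm_nonneg _
  choose v hv hmin using hmin
  obtain ⟨R, hR⟩ := hbdd
  have hmono : Monotone fun n => ‖v n‖ ^ 2 := fun m n hmn =>
    pow_le_pow_left₀ (norm_nonneg _) (hmin m _ (hanti hmn (hv n))) 2
  have hbd : BddAbove (range fun n => ‖v n‖ ^ 2) := by
    refine ⟨R ^ 2, ?_⟩
    rintro _ ⟨n, rfl⟩
    exact pow_le_pow_left₀ (norm_nonneg _) (hR _ (hanti (Nat.zero_le _) (hv n))) 2
  have hlim := tendsto_atTop_ciSup hmono hbd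
  -- The midpoint of the minimal-norm points `v m` and `v n` stays in `K m`, so its norm is at least
  -- `‖v m‖`; the parallelogram law does the rest.
  have hdist : ∀ m n, m ≤ n → ‖v n - v m‖ ^ 2 ≤ 2 * (‖v n‖ ^ 2 - ‖v m‖ ^ 2) := by
    intro m n hmn
    have hmid : (1 / 2 : ℝ) • v m + (1 / 2 : ℝ) • v n ∈ K m :=
      hconv m (hv m) (hanti hmn (hv n)) (by norm_num) (by norm_num) (by norm_num)
    have h1 := hmin m _ hmid
    rw [← smul_add, norm_smul] at h1
    have h2 := parallelogram_law_with_norm ℝ (v n) (v m)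
    have h3 : 2 * ‖v m‖ ≤ ‖v n + v m‖ := by
      rw [add_comm]; norm_num at h1; linarith
    nlinarith [norm_nonneg (v m)]
  have hcauchy : CauchySeq v := by
    rw [Metric.cauchySeq_iff']
    intro ε hε
    have hc := Metric.cauchySeq_iff'.1 hlim.cauchySeq (ε ^ 2 / 2) (by positivity)
    obtain ⟨N, hN⟩ := hc
    refine ⟨N, fun n hn => ?_⟩
    have h1 := hdist N n hn
    have h2 := (le_abs_self _).trans_lt (hN n hn)
    rw [dist_eq_norm]
    refine lt_of_pow_lt_pow_left₀ 2 hε.le ?_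
    linarith
  obtain ⟨x, hx⟩ := cauchySeq_tendsto_of_complete hcauchy
  refine ⟨x, mem_iInter.2 fun n => (hcl n).mem_of_tendsto hx ?_⟩
  filter_upwards [eventually_ge_atTop n] with m hm using hanti hm (hv m)

/-- Duality for a convex minimisation problem under a linear constraint `T x = y`, the objective
being given by its closed convex epigraph `E` with bounded sublevel sets. -/
theorem exists_mem_epigraph_of_dual_le {H K : Type*} [NormedAddCommGroup H] [InnerProductSpace ℝ H]
    [CompleteSpace H] [NormedAddCommGroup K] [NormedSpace ℝ K] (E : Set (H × ℝ))
    (hcl : IsClosed E) (hconv : Convex ℝ E) (hup : ∀ x r s, (x, r) ∈ E → r ≤ s → (x, s) ∈ E)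
    (hbdd : ∀ r, ∃ R, ∀ x, (x, r) ∈ E → ‖x‖ ≤ R) (T : H →L[ℝ] K) (y : K) (D : ℝ)
    (hfeas : ∃ x r, (x, r) ∈ E ∧ T x = y)
    (hdual : ∀ φ : K →L[ℝ] ℝ, ∃ x r, (x, r) ∈ E ∧ r + φ (T x - y) ≤ D) :
    ∃ x, T x = y ∧ (x, D) ∈ E := by
  obtain ⟨x₀, r₀, h₀, hT₀⟩ := hfeas
  let L : H × ℝ →L[ℝ] ℝ × K :=
    (ContinuousLinearMap.snd ℝ H ℝ).prod (T.comp (ContinuousLinearMap.fst ℝ H ℝ))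
  -- Otherwise a hyperplane strictly separates this point from the closed convex set; normalising
  -- its coefficient on the cost axis to 1 produces a multiplier contradicting `hdual`.
  have hclos : ∀ ε > 0, (D + ε, y) ∈ closure (L '' E) := by
    intro ε hε
    by_contra hnot
    obtain ⟨f, u, hu, hf⟩ := geometric_hahn_banach_point_closed
      (hconv.linear_image L.toLinearMap).closure isClosed_closure hnot
    have hval : ∀ r k, f (r, k) = f (1, 0) * r + f (0, k) := by
      intro r k
      have : ((r, k) : ℝ × K) = r • (1, 0) + (0, k) := by simp
      rw [this, map_add, map_smul, smul_eq_mul, mul_comm]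
    have hE : ∀ x r, (x, r) ∈ E →
        f (1, 0) * (D + ε) + f (0, y) < f (1, 0) * r + f (0, T x) := by
      intro x r h
      rw [← hval, ← hval]
      exact hu.trans (hf _ (subset_closure ⟨(x, r), h, rfl⟩))
    -- Feasibility rules out a vertical or inverted hyperplane: over `x₀` the cost may be raised to
    -- at least `D + ε` without changing the constraint value.
    have hpos : 0 < f (1, 0) := by
      by_contra! hle
      have := hE x₀ _ (hup _ _ (max r₀ (D + ε)) h₀ (le_max_left _ _))
      rw [hT₀] at this
      nlinarith [mul_le_mul_of_nonpos_left (le_max_right r₀ (D + ε)) hle]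
    obtain ⟨x, r, hxr, hle⟩ := hdual ((f (1, 0))⁻¹ • f.comp (ContinuousLinearMap.inr ℝ ℝ K))
    have h1 := hE x r hxr
    simp only [_root_.smul_apply, ContinuousLinearMap.comp_apply,
      ContinuousLinearMap.inr_apply, smul_eq_mul] at hle
    have h2 : f (0, T x - y) = f (0, T x) - f (0, y) := by
      rw [← map_sub]; simp
    rw [h2] at hle
    have h3 := mul_le_mul_of_nonneg_left hle hpos.le
    rw [mul_add, mul_inv_cancel_left₀ hpos.ne'] at h3
    nlinarith [mul_pos hpos hε]
  have hε : ∀ n : ℕ, (0 : ℝ) < 1 / (n + 1) := fun n => Nat.one_div_pos_of_nat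
  have hanti : Antitone fun n : ℕ => (1 : ℝ) / (n + 1) := fun m n h => Nat.one_div_le_one_div h
  -- Both the cost bound and the constraint are relaxed by 1/(n+1). Half of this slack is the ε of
  -- `hclos`, the other half the distance to a point of the image.
  obtain ⟨x, hx⟩ := nonempty_iInter_of_convex
    (fun n : ℕ => {x | (x, D + 1 / (n + 1)) ∈ E} ∩ T ⁻¹' Metric.closedBall y (1 / (n + 1)))
    (fun m n h x hx => ⟨hup _ _ _ hx.1 (by have := hanti h; simp only at this; linarith),
      Metric.closedBall_subset_closedBall (hanti h) hx.2⟩)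
    (fun n => by
      obtain ⟨_, ⟨⟨x, r⟩, hxr, rfl⟩, hd⟩ := Metric.mem_closure_iff.1
        (hclos _ (half_pos (hε n))) _ (half_pos (hε n))
      have hd' : dist (D + 1 / (n + 1) / 2, y) (r, T x) < 1 / ((n : ℝ) + 1) / 2 := hd
      rw [Prod.dist_eq, max_lt_iff] at hd'
      refine ⟨x, hup _ _ _ hxr ?_, ?_⟩
      · have h := hd'.1
        rw [Real.dist_eq, abs_lt] at h
        linarith [h.1]
      · have h := hd'.2
        rw [dist_comm] at h
        exact Metric.mem_closedBall.2 (h.le.trans (half_le_self (hε n).le)))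
    (fun n => (hcl.preimage (by fun_prop)).inter (Metric.isClosed_closedBall.preimage T.continuous))
    (fun n => by
      refine Convex.inter ?_ ((convex_closedBall y _).linear_preimage T.toLinearMap)
      intro x hx z hz a b ha hb hab
      have h := hconv hx hz ha hb hab
      simp only [Prod.smul_mk, Prod.mk_add_mk, ← add_smul, hab, one_smul] at h
      exact h)
    (by
      obtain ⟨R, hR⟩ := hbdd (D + 1 / (((0 : ℕ) : ℝ) + 1))
      exact ⟨R, fun x hx => hR x hx.1⟩)
  rw [mem_iInter] at hx
  have hlim := tendsto_one_div_add_atTop_nhds_zero_nat (𝕜 := ℝ)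
  refine ⟨x, ?_, ?_⟩
  · refine dist_le_zero.1 (ge_of_tendsto' hlim fun n => (hx n).2)
  · have h : Filter.Tendsto (fun n : ℕ => (x, D + 1 / ((n : ℝ) + 1))) Filter.atTop
        (nhds (x, D + 0)) := tendsto_const_nhds.prodMk_nhds (tendsto_const_nhds.add hlim)
    rw [add_zero] at h
    exact hcl.mem_of_tendsto h (Filter.Eventually.of_forall fun n => (hx n).1)

/-! ### H¹ functions and bounded operators on L²(0,1) -/

/-- Lebesgue measure on the unit interval. -/
noncomputable abbrev unitMeasure : Measure ℝ := volume.restrict (Icc (0 : ℝ) 1)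

instance : IsProbabilityMeasure unitMeasure := ⟨by simp⟩

lemma intervalIntegrable_of_integrable_unit {g : ℝ → ℝ} (hg : Integrable g unitMeasure) {s t : ℝ}
    (hs : s ∈ Icc (0 : ℝ) 1) (ht : t ∈ Icc (0 : ℝ) 1) : IntervalIntegrable g volume s t := by
  have h : IntervalIntegrable g volume 0 1 := by
    rw [intervalIntegrable_iff_integrableOn_Icc_of_le zero_le_one]; exact hg
  refine h.mono_set ?_
  rw [uIcc_of_le (zero_le_one' ℝ)]
  exact (convex_Icc 0 1).ordConnected.uIcc_subset hs ht

lemma MemLp.integrable_unit {g : ℝ → ℝ} (hg : MemLp g 2 unitMeasure) : Integrable g unitMeasure :=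
  hg.integrable one_le_two

lemma integral_unit (g : ℝ → ℝ) : ∫ s in (0 : ℝ)..1, g s = ∫ s, g s ∂unitMeasure := by
  rw [intervalIntegral.integral_of_le zero_le_one, integral_Icc_eq_integral_Ioc]

lemma intervalIntegral_congr_unit {g h : ℝ → ℝ} (hgh : g =ᵐ[unitMeasure] h) {t : ℝ}
    (ht : t ∈ Icc (0 : ℝ) 1) : ∫ s in (0 : ℝ)..t, g s = ∫ s in (0 : ℝ)..t, h s := by
  refine intervalIntegral.integral_congr_ae ?_
  filter_upwards [(ae_restrict_iff' measurableSet_Icc).1 hgh] with s hs hst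
  rw [uIoc_of_le ht.1] at hst
  exact hs ⟨hst.1.le, hst.2.trans ht.2⟩

lemma continuousOn_primitive_unit {g : ℝ → ℝ} (hg : Integrable g unitMeasure) :
    ContinuousOn (fun t => ∫ s in (0 : ℝ)..t, g s) (Icc 0 1) := by
  have := intervalIntegral.continuousOn_primitive_interval (μ := volume) (a := (0 : ℝ)) (b := 1)
    (f := g) (by rw [uIcc_of_le (zero_le_one' ℝ)]; exact hg)
  rwa [uIcc_of_le (zero_le_one' ℝ)] at this

lemma memLp_of_continuousOn {f : ℝ → ℝ} (hf : ContinuousOn f (Icc 0 1)) {p : ℝ≥0∞} :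
    MemLp f p unitMeasure := by
  obtain ⟨C, hC⟩ := isCompact_Icc.exists_bound_of_continuousOn hf
  exact MemLp.of_bound (hf.aestronglyMeasurable measurableSet_Icc) C
    ((ae_restrict_iff' measurableSet_Icc).2 (ae_of_all _ hC))

lemma HasH1Deriv.of_integral {g : ℝ → ℝ} (c : ℝ) (hg : MemLp g 2 unitMeasure) :
    HasH1Deriv (fun t => c + ∫ s in (0 : ℝ)..t, g s) g :=
  ⟨hg, fun t _ => by simp⟩

lemma HasH1Deriv.continuousOn {f g : ℝ → ℝ} (h : HasH1Deriv f g) : ContinuousOn f (Icc 0 1) :=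
  (continuousOn_const.add (continuousOn_primitive_unit (MemLp.integrable_unit h.1))).congr h.2

lemma HasH1Deriv.memLp {f g : ℝ → ℝ} (h : HasH1Deriv f g) {p : ℝ≥0∞} : MemLp f p unitMeasure :=
  memLp_of_continuousOn h.continuousOn

lemma MemLp.mul_continuousOn {f g : ℝ → ℝ} (hf : ContinuousOn f (Icc 0 1)) {p : ℝ≥0∞}
    (hg : MemLp g p unitMeasure) : MemLp (fun t => f t * g t) p unitMeasure :=
  hg.mul (memLp_of_continuousOn hf (p := ∞))

lemma HasH1Deriv.add {f g F G : ℝ → ℝ} (h : HasH1Deriv f g) (H : HasH1Deriv F G) :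
    HasH1Deriv (fun t => f t + F t) (fun t => g t + G t) := by
  refine ⟨h.1.add H.1, fun t ht => ?_⟩
  have h0 : (0 : ℝ) ∈ Icc (0 : ℝ) 1 := by simp
  simp only
  rw [intervalIntegral.integral_add
    (intervalIntegrable_of_integrable_unit (MemLp.integrable_unit h.1) h0 ht)
    (intervalIntegrable_of_integrable_unit (MemLp.integrable_unit H.1) h0 ht), h.2 t ht, H.2 t ht]
  ring

/-- Integration by parts for `H¹` functions. -/
lemma HasH1Deriv.integral_mul {f g F G : ℝ → ℝ} (h : HasH1Deriv f g) (H : HasH1Deriv F G) :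
    f 1 * F 1 - f 0 * F 0 = ∫ t, (g t * F t + f t * G t) ∂unitMeasure := by
  have h0 : (0 : ℝ) ∈ Icc (0 : ℝ) 1 := by simp
  have h1 : (1 : ℝ) ∈ Icc (0 : ℝ) 1 := by simp
  -- Nothing is known of `f` outside [0,1], so the product rule is applied to the primitives, which
  -- are defined on the whole line and agree with `f` and `F` on [0,1].
  have ac {g : ℝ → ℝ} (c : ℝ) (hg : MemLp g 2 unitMeasure) :
      AbsolutelyContinuousOnInterval (fun t => c + ∫ s in (0 : ℝ)..t, g s) 0 1 :=
    (LipschitzOnWith.absolutelyContinuousOnInterval (K := 0) (f := fun _ : ℝ => c)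
        (LipschitzWith.const c).lipschitzOnWith).fun_add
      ((intervalIntegrable_of_integrable_unit (MemLp.integrable_unit hg) h0
        h1).absolutelyContinuousOnInterval_intervalIntegral (by simp))
  have der {g : ℝ → ℝ} (c : ℝ) (hg : MemLp g 2 unitMeasure) : ∀ᵐ t, t ∈ Icc (0 : ℝ) 1 →
      deriv (fun t => c + ∫ s in (0 : ℝ)..t, g s) t = g t := by
    filter_upwards [(intervalIntegrable_of_integrable_unit (MemLp.integrable_unit hg) h0
      h1).ae_hasDerivAt_integral] with t ht hti
    exact ((ht (by rwa [uIcc_of_le (zero_le_one' ℝ)]) 0 (by simp)).const_add c).deriv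
  have key := (ac (f 0) h.1).integral_deriv_mul_eq_sub (ac (F 0) H.1)
  rw [integral_unit] at key
  simp only [← h.2 1 h1, ← H.2 1 h1, intervalIntegral.integral_same, add_zero] at key
  rw [← key]
  refine integral_congr_ae ?_
  refine (ae_restrict_iff' measurableSet_Icc).2 ?_
  filter_upwards [der (f 0) h.1, der (F 0) H.1] with t h1 h2 ht
  rw [h1 ht, h2 ht, h.2 t ht, H.2 t ht]

/-- On a probability space the L¹ norm is at most the L² norm. This is the operator bound behind
both `integralTo` and `volterra`. -/
lemma norm_integral_le_norm_unit (g : Lp ℝ 2 unitMeasure) {t : ℝ} (ht : t ∈ Icc (0 : ℝ) 1) :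
    ‖∫ s in (0 : ℝ)..t, g s‖ ≤ ‖g‖ := by
  have hg := Lp.memLp g
  have hi : Integrable g unitMeasure := MemLp.integrable_unit hg
  calc ‖∫ s in (0 : ℝ)..t, g s‖ ≤ ∫ s in (0 : ℝ)..t, ‖g s‖ :=
        intervalIntegral.norm_integral_le_integral_norm ht.1
    _ ≤ ∫ s, ‖g s‖ ∂unitMeasure := by
        rw [intervalIntegral.integral_of_le ht.1]
        refine setIntegral_mono_set hi.norm (ae_of_all _ fun _ => norm_nonneg _) ?_
        exact (Ioc_subset_Icc_self.trans (Icc_subset_Icc_right ht.2)).eventuallyLE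
    _ = (eLpNorm g 1 unitMeasure).toReal := by
        rw [eLpNorm_one_eq_lintegral_enorm, integral_norm_eq_lintegral_enorm hi.1]
    _ ≤ (eLpNorm g 2 unitMeasure).toReal :=
        ENNReal.toReal_mono hg.2.ne (eLpNorm_le_eLpNorm_of_exponent_le one_le_two hg.1)
    _ = ‖g‖ := (Lp.norm_def g).symm

/-- Integration over the initial interval `[0,t]`, as a functional on `L²(0,1)`. -/
noncomputable def integralTo (t : ℝ) (ht : t ∈ Icc (0 : ℝ) 1) : Lp ℝ 2 unitMeasure →L[ℝ] ℝ :=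
  LinearMap.mkContinuous
    { toFun := fun g => ∫ s in (0 : ℝ)..t, g s
      map_add' := fun g h => by
        have h0 : (0 : ℝ) ∈ Icc (0 : ℝ) 1 := by simp
        rw [intervalIntegral_congr_unit (Lp.coeFn_add g h) ht]
        exact intervalIntegral.integral_add
          (intervalIntegrable_of_integrable_unit (MemLp.integrable_unit (Lp.memLp g)) h0 ht)
          (intervalIntegrable_of_integrable_unit (MemLp.integrable_unit (Lp.memLp h)) h0 ht)
      map_smul' := fun c g => by
        rw [intervalIntegral_congr_unit (Lp.coeFn_smul c g) ht]
        exact intervalIntegral.integral_smul c _ } 1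
    (fun g => by simpa using norm_integral_le_norm_unit g ht)

lemma integralTo_apply (t : ℝ) (ht : t ∈ Icc (0 : ℝ) 1) (g : Lp ℝ 2 unitMeasure) :
    integralTo t ht g = ∫ s in (0 : ℝ)..t, g s := rfl

lemma memLp_primitive (g : Lp ℝ 2 unitMeasure) :
    MemLp (fun t => ∫ s in (0 : ℝ)..t, g s) 2 unitMeasure :=
  memLp_of_continuousOn (continuousOn_primitive_unit (MemLp.integrable_unit (Lp.memLp g)))

/-- The Volterra operator `g ↦ ∫₀ᵗ g` on `L²(0,1)`. -/
noncomputable def volterra : Lp ℝ 2 unitMeasure →L[ℝ] Lp ℝ 2 unitMeasure :=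
  LinearMap.mkContinuous
    { toFun := fun g => (memLp_primitive g).toLp
      map_add' := fun g h => by
        rw [← MemLp.toLp_add]
        refine (MemLp.toLp_eq_toLp_iff _ _).2 ((ae_restrict_iff' measurableSet_Icc).2 ?_)
        exact ae_of_all _ fun t ht => (integralTo t ht).map_add g h
      map_smul' := fun c g => by
        rw [RingHom.id_apply, ← MemLp.toLp_const_smul]
        refine (MemLp.toLp_eq_toLp_iff _ _).2 ((ae_restrict_iff' measurableSet_Icc).2 ?_)
        exact ae_of_all _ fun t ht => (integralTo t ht).map_smul c g } 1
    (fun g => by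
      have h := Lp.norm_le_of_ae_bound (f := (memLp_primitive g).toLp) (norm_nonneg g) (by
        filter_upwards [(memLp_primitive g).coeFn_toLp,
          ae_restrict_mem measurableSet_Icc] with t h1 h2
        rw [h1]
        exact norm_integral_le_norm_unit g h2)
      simpa [measureUnivNNReal] using h)

lemma coeFn_volterra (g : Lp ℝ 2 unitMeasure) :
    volterra g =ᵐ[unitMeasure] fun t => ∫ s in (0 : ℝ)..t, g s :=
  (memLp_primitive g).coeFn_toLp

lemma memLp_mul_bounded {a : ℝ → ℝ} (ha : MemLp a ∞ unitMeasure) {g : ℝ → ℝ} {p : ℝ≥0∞}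
    (hg : MemLp g p unitMeasure) : MemLp (fun t => a t * g t) p unitMeasure :=
  hg.mul ha

lemma norm_toLp_mul_bounded_le {a : ℝ → ℝ} (ha : MemLp a ∞ unitMeasure)
    (g : Lp ℝ 2 unitMeasure) :
    ‖(memLp_mul_bounded ha (Lp.memLp g)).toLp‖ ≤ (eLpNorm a ∞ unitMeasure).toReal * ‖g‖ := by
  rw [Lp.norm_toLp, Lp.norm_def, ← ENNReal.toReal_mul]
  refine ENNReal.toReal_mono (ENNReal.mul_ne_top ha.2.ne (Lp.memLp g).2.ne) ?_
  exact eLpNorm_smul_le_mul_eLpNorm (f := (g : ℝ → ℝ)) (φ := a) (p := ∞) (q := 2) (r := 2)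
    (Lp.memLp g).1 ha.1

/-- Multiplication by a bounded measurable function, as an operator on `L²(0,1)`. -/
noncomputable def mulBounded (a : ℝ → ℝ) (ha : MemLp a ∞ unitMeasure) :
    Lp ℝ 2 unitMeasure →L[ℝ] Lp ℝ 2 unitMeasure :=
  LinearMap.mkContinuous
    { toFun := fun g => (memLp_mul_bounded ha (Lp.memLp g)).toLp
      map_add' := fun g h => by
        rw [← MemLp.toLp_add]
        refine (MemLp.toLp_eq_toLp_iff _ _).2 ?_
        filter_upwards [Lp.coeFn_add g h] with t ht
        rw [ht, Pi.add_apply, Pi.add_apply, mul_add]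
      map_smul' := fun c g => by
        rw [RingHom.id_apply, ← MemLp.toLp_const_smul]
        refine (MemLp.toLp_eq_toLp_iff _ _).2 ?_
        filter_upwards [Lp.coeFn_smul c g] with t ht
        rw [ht, Pi.smul_apply, Pi.smul_apply, smul_eq_mul, smul_eq_mul, mul_left_comm] }
    (eLpNorm a ∞ unitMeasure).toReal (fun g => norm_toLp_mul_bounded_le ha g)

lemma coeFn_mulBounded (a : ℝ → ℝ) (ha : MemLp a ∞ unitMeasure) (g : Lp ℝ 2 unitMeasure) :
    mulBounded a ha g =ᵐ[unitMeasure] fun t => a t * g t :=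
  MemLp.coeFn_toLp (memLp_mul_bounded ha (Lp.memLp g))

/-! ### The edge cost -/

/-- For x > 0 this is (kx - y)² ≥ 0; elsewhere the cost is infinite or x = y = 0. It is the
Fenchel–Young inequality with slope k. -/
lemma ofReal_le_edgeCost (x y k : ℝ) : ENNReal.ofReal (2 * k * y - k ^ 2 * x) ≤ edgeCost x y := by
  unfold edgeCost
  split_ifs with hx h
  · refine ENNReal.ofReal_le_ofReal ?_
    rw [le_div_iff₀ hx]
    nlinarith [sq_nonneg (k * x - y)]
  · simp [h.1, h.2]
  · exact le_top

/-- The edge cost is a supremum of linear functions. -/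
lemma edgeCost_eq_iSup (x y : ℝ) :
    edgeCost x y = ⨆ k : ℝ, ENNReal.ofReal (2 * k * y - k ^ 2 * x) := by
  refine le_antisymm ?_ (iSup_le (ofReal_le_edgeCost x y))
  unfold edgeCost
  split_ifs with hx h
  · refine le_iSup_of_le (y / x) (ENNReal.ofReal_le_ofReal (le_of_eq ?_))
    field_simp
    ring
  · exact zero_le
  -- Here x ≤ 0. If y ≠ 0, slopes proportional to 1/y make the linear term as large as desired; if y
  -- = 0, then x < 0 and the quadratic term does so.
  · refine top_le_iff.2 (ENNReal.eq_top_of_forall_nnreal_le fun r => ?_)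
    suffices h : ∃ k : ℝ, (r : ℝ) ≤ 2 * k * y - k ^ 2 * x by
      obtain ⟨k, hk⟩ := h
      refine le_iSup_of_le k ?_
      rw [← ENNReal.ofReal_coe_nnreal]
      exact ENNReal.ofReal_le_ofReal hk
    rcases eq_or_ne y 0 with rfl | hy
    · have hx' : x < 0 := lt_of_le_of_ne (not_lt.1 hx) fun h0 => h ⟨h0, rfl⟩
      refine ⟨√(r / -x), ?_⟩
      have hsq : √((r : ℝ) / -x) ^ 2 = r / -x := Real.sq_sqrt (div_nonneg r.2 (by linarith))
      rw [hsq]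
      have : (r : ℝ) / -x * x = -r := by
        rw [div_neg, neg_mul, div_mul_cancel₀ _ hx'.ne]
      linarith
    · refine ⟨r / (2 * y), ?_⟩
      have h1 : 2 * ((r : ℝ) / (2 * y)) * y = r := by field_simp
      have h2 := mul_nonpos_of_nonneg_of_nonpos (sq_nonneg ((r : ℝ) / (2 * y))) (not_lt.1 hx)
      linarith

lemma edgeCost_convex {a b : ℝ} (ha : 0 ≤ a) (hb : 0 ≤ b) (x y x' y' : ℝ) :
    edgeCost (a * x + b * x') (a * y + b * y') ≤
      ENNReal.ofReal a * edgeCost x y + ENNReal.ofReal b * edgeCost x' y' := by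
  rw [edgeCost_eq_iSup]
  refine iSup_le fun k => ?_
  have : 2 * k * (a * y + b * y') - k ^ 2 * (a * x + b * x') =
      a * (2 * k * y - k ^ 2 * x) + b * (2 * k * y' - k ^ 2 * x') := by ring
  rw [this]
  refine ENNReal.ofReal_add_le.trans ?_
  rw [ENNReal.ofReal_mul ha, ENNReal.ofReal_mul hb]
  gcongr <;> exact ofReal_le_edgeCost _ _ _

lemma lowerSemicontinuous_edgeCost {X : Type*} [TopologicalSpace X] {f g : X → ℝ}
    (hf : Continuous f) (hg : Continuous g) :
    LowerSemicontinuous fun z => edgeCost (f z) (g z) := by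
  simp only [edgeCost_eq_iSup]
  refine lowerSemicontinuous_iSup fun k => Continuous.lowerSemicontinuous ?_
  exact ENNReal.continuous_ofReal.comp (by fun_prop)

/-- Equality case of `ofReal_le_edgeCost`: the flux k x attains the bound of slope k, also when x =
0. -/
lemma edgeCost_self_mul {x : ℝ} (hx : 0 ≤ x) (k : ℝ) :
    edgeCost x (k * x) = ENNReal.ofReal (k ^ 2 * x) := by
  unfold edgeCost
  split_ifs with h h'
  · congr 1
    field_simp
  · simp [h'.1]
  · have : x = 0 := le_antisymm (not_lt.1 h) hx
    simp [this] at h'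

/-! ### Pairs of a density and a flux -/

section

variable {V : Type*}

/-- The space of pairs of a node function and an edge function. -/
abbrev PairSpace (V : Type*) := EuclideanSpace ℝ (V ⊕ V × V)

/-- The node part of a pair. -/
def mass (z : PairSpace V) (i : V) : ℝ := z (Sum.inl i)

/-- The edge part of a pair. -/
def flux (z : PairSpace V) (i j : V) : ℝ := z (Sum.inr (i, j))

/-- The pair with given node and edge parts. -/
def toPair (ρ : V → ℝ) (m : V → V → ℝ) : PairSpace V :=
  WithLp.toLp 2 (Sum.elim ρ fun e => m e.1 e.2)

@[simp] lemma mass_toPair (ρ : V → ℝ) (m : V → V → ℝ) : mass (toPair ρ m) = ρ := rfl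

@[simp] lemma flux_toPair (ρ : V → ℝ) (m : V → V → ℝ) : flux (toPair ρ m) = m := rfl

@[fun_prop] lemma continuous_mass (i : V) : Continuous fun z : PairSpace V => mass z i := by
  unfold mass; fun_prop

@[fun_prop] lemma continuous_flux (i j : V) : Continuous fun z : PairSpace V => flux z i j := by
  unfold flux; fun_prop

lemma mass_combo (a b : ℝ) (z w : PairSpace V) : mass (a • z + b • w) = a • mass z + b • mass w :=
  rfl

lemma flux_combo (a b : ℝ) (z w : PairSpace V) : flux (a • z + b • w) = a • flux z + b • flux w :=
  rfl

variable [Fintype V]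

lemma norm_sq_pair (z : PairSpace V) :
    ‖z‖ ^ 2 = ∑ i, mass z i ^ 2 + ∑ i, ∑ j, flux z i j ^ 2 := by
  rw [EuclideanSpace.real_norm_sq_eq, Fintype.sum_sum_type, Fintype.sum_prod_type]
  rfl

lemma le_one_of_mem_stdSimplex {ρ : V → ℝ} (hρ : ρ ∈ stdSimplex ℝ V) (i : V) : ρ i ≤ 1 :=
  (mem_Icc_of_mem_stdSimplex hρ i).2

lemma theta_nonneg {ρ : V → ℝ} (hρ : ρ ∈ stdSimplex ℝ V) (i j : V) : 0 ≤ theta ρ i j := by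
  have h1 := hρ.1 i
  have h2 := hρ.1 j
  unfold theta
  linarith

lemma theta_le_one {ρ : V → ℝ} (hρ : ρ ∈ stdSimplex ℝ V) (i j : V) : theta ρ i j ≤ 1 := by
  have h1 := le_one_of_mem_stdSimplex hρ i
  have h2 := le_one_of_mem_stdSimplex hρ j
  unfold theta
  linarith

variable (G : SimpleGraph V)

/-- The pairs of a probability density and a skew-symmetric edge function of the graph. -/
def pairConstraint : Set (PairSpace V) :=
  {z | mass z ∈ stdSimplex ℝ V ∧ (∀ i j, flux z i j = -flux z j i) ∧
    ∀ i j, ¬ G.Adj i j → flux z i j = 0}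

lemma isClosed_pairConstraint : IsClosed (pairConstraint G) := by
  refine IsClosed.inter (s₁ := {z | mass z ∈ stdSimplex ℝ V})
    ((isClosed_stdSimplex ℝ V).preimage (continuous_pi fun i => continuous_mass i))
    (IsClosed.inter (s₁ := {z | ∀ i j, flux z i j = -flux z j i}) ?_ ?_)
  · simp only [ofPred_forall]
    exact isClosed_iInter fun i => isClosed_iInter fun j =>
      isClosed_eq (by fun_prop) (by fun_prop)
  · change IsClosed {z : PairSpace V | ∀ i j, ¬ G.Adj i j → flux z i j = 0}
    simp only [ofPred_forall]
    exact isClosed_iInter fun i => isClosed_iInter fun j => isClosed_iInter fun _ =>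
      isClosed_eq (by fun_prop) (by fun_prop)

lemma convex_pairConstraint : Convex ℝ (pairConstraint G) := by
  intro z hz w hw a b ha hb hab
  refine ⟨?_, fun i j => ?_, fun i j hij => ?_⟩
  · rw [mass_combo]
    exact convex_stdSimplex ℝ V hz.1 hw.1 ha hb hab
  · simp only [flux_combo, Pi.add_apply, Pi.smul_apply, smul_eq_mul]
    rw [hz.2.1 i j, hw.2.1 i j]
    ring
  · simp [flux_combo, hz.2.2 i j hij, hw.2.2 i j hij]

variable [DecidableRel G.Adj]

/-- The cost density of the action. -/
noncomputable def cost (z : PairSpace V) : ℝ≥0∞ :=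
  4⁻¹ * ∑ i, ∑ j ∈ G.neighborFinset i, edgeCost (theta (mass z) i j) (flux z i j)

lemma lowerSemicontinuous_cost : LowerSemicontinuous (cost G) := by
  refine (ENNReal.continuous_const_mul (by simp)).comp_lowerSemicontinuous ?_
    (fun _ _ h => mul_le_mul_right h _)
  refine lowerSemicontinuous_sum fun i _ => lowerSemicontinuous_sum fun j _ => ?_
  exact lowerSemicontinuous_edgeCost (by unfold theta; fun_prop) (by fun_prop)

lemma measurable_cost : Measurable (cost G) := (lowerSemicontinuous_cost G).measurable

lemma cost_convex {a b : ℝ} (ha : 0 ≤ a) (hb : 0 ≤ b) (z w : PairSpace V) :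
    cost G (a • z + b • w) ≤ ENNReal.ofReal a * cost G z + ENNReal.ofReal b * cost G w := by
  unfold cost
  rw [mul_left_comm, mul_left_comm (ENNReal.ofReal b), ← mul_add]
  gcongr
  simp only [Finset.mul_sum, ← Finset.sum_add_distrib]
  refine Finset.sum_le_sum fun i _ => Finset.sum_le_sum fun j _ => ?_
  refine le_trans (le_of_eq ?_) (edgeCost_convex ha hb _ _ _ _)
  rw [mass_combo, flux_combo]
  congr 1
  simp only [theta, Pi.add_apply, Pi.smul_apply, smul_eq_mul]
  ring

/-- Coercivity: the masses contribute at most 1, and θ ≤ 1 makes each edge cost at least the squared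
flux. Off the edges, which the cost does not see, the flux vanishes by constraint. -/
lemma ofReal_norm_sq_le_cost {z : PairSpace V} (hz : z ∈ pairConstraint G) :
    ENNReal.ofReal (‖z‖ ^ 2) ≤ 1 + 4 * cost G z := by
  rw [norm_sq_pair, ENNReal.ofReal_add (by positivity) (by positivity)]
  gcongr
  · rw [← ENNReal.ofReal_one]
    refine ENNReal.ofReal_le_ofReal ?_
    rw [← hz.1.2]
    refine Finset.sum_le_sum fun i _ => ?_
    have h1 := hz.1.1 i
    have h2 := le_one_of_mem_stdSimplex hz.1 i
    nlinarith
  · unfold cost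
    rw [← mul_assoc, ENNReal.mul_inv_cancel (by simp) (by simp), one_mul,
      ENNReal.ofReal_sum_of_nonneg fun i _ => by positivity]
    refine Finset.sum_le_sum fun i _ => ?_
    rw [← Finset.sum_subset (Finset.subset_univ (G.neighborFinset i)) fun j _ hj => by
      rw [hz.2.2 i j (by simpa using hj)]; simp, ENNReal.ofReal_sum_of_nonneg fun j _ => by positivity]
    refine Finset.sum_le_sum fun j _ => ?_
    -- Slope k = y gives 2y² - y²θ ≥ y².
    refine le_trans (ENNReal.ofReal_le_ofReal ?_) (ofReal_le_edgeCost _ _ (flux z i j))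
    nlinarith [theta_le_one hz.1 i j, sq_nonneg (flux z i j)]

/-! ### The epigraph of the action -/

/-- The epigraph of the action on `L²` pairs of a density and a flux. -/
def actionEpigraph : Set (Lp (PairSpace V) 2 unitMeasure × ℝ) :=
  {p | (∀ᵐ t ∂unitMeasure, p.1 t ∈ pairConstraint G) ∧
    -- `ENNReal.ofReal` sends negative numbers to 0, so the sign condition is what keeps points
    -- below the graph out of the set.
    ∫⁻ t, cost G (p.1 t) ∂unitMeasure ≤ ENNReal.ofReal p.2 ∧ 0 ≤ p.2}

lemma measurable_cost_comp (f : Lp (PairSpace V) 2 unitMeasure) :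
    Measurable fun t => cost G (f t) :=
  (measurable_cost G).comp (Lp.stronglyMeasurable f).measurable

lemma convex_actionEpigraph : Convex ℝ (actionEpigraph G) := by
  rintro ⟨f, r⟩ ⟨hf, hfr, hr⟩ ⟨g, s⟩ ⟨hg, hgs, hs⟩ a b ha hb hab
  simp only at hf hfr hr hg hgs hs
  have hae : ∀ᵐ t ∂unitMeasure, (a • f + b • g : Lp (PairSpace V) 2 unitMeasure) t =
      a • f t + b • g t := by
    filter_upwards [Lp.coeFn_add (a • f) (b • g), Lp.coeFn_smul a f, Lp.coeFn_smul b g]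
      with t h1 h2 h3
    rw [h1, Pi.add_apply, h2, h3, Pi.smul_apply, Pi.smul_apply]
  refine ⟨?_, ?_, add_nonneg (mul_nonneg ha hr) (mul_nonneg hb hs)⟩
  · filter_upwards [hae, hf, hg] with t h1 h2 h3
    change (a • f + b • g : Lp (PairSpace V) 2 unitMeasure) t ∈ _
    rw [h1]
    exact convex_pairConstraint G h2 h3 ha hb hab
  · calc ∫⁻ t, cost G ((a • f + b • g : Lp (PairSpace V) 2 unitMeasure) t) ∂unitMeasure
        ≤ ∫⁻ t, (ENNReal.ofReal a * cost G (f t) + ENNReal.ofReal b * cost G (g t))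
            ∂unitMeasure := by
          refine lintegral_mono_ae ?_
          filter_upwards [hae] with t h1
          rw [h1]
          exact cost_convex G ha hb _ _
      _ = ENNReal.ofReal a * ∫⁻ t, cost G (f t) ∂unitMeasure +
            ENNReal.ofReal b * ∫⁻ t, cost G (g t) ∂unitMeasure := by
          rw [lintegral_add_left ((measurable_cost_comp G f).const_mul _),
            lintegral_const_mul _ (measurable_cost_comp G f),
            lintegral_const_mul _ (measurable_cost_comp G g)]
      _ ≤ ENNReal.ofReal a * ENNReal.ofReal r + ENNReal.ofReal b * ENNReal.ofReal s := by
          gcongr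
      _ = ENNReal.ofReal (a * r + b * s) := by
          rw [ENNReal.ofReal_add (mul_nonneg ha hr) (mul_nonneg hb hs), ENNReal.ofReal_mul ha,
            ENNReal.ofReal_mul hb]

-- L² convergence gives an a.e. convergent subsequence; lower semicontinuity of the cost and Fatou's
-- lemma then pass to the limit.
open Filter Topology in
lemma isClosed_actionEpigraph : IsClosed (actionEpigraph G) := by
  refine IsSeqClosed.isClosed fun p q hp hpq => ?_
  have h1 : Tendsto (fun n => (p n).1) atTop (𝓝 q.1) := (continuous_fst.tendsto q).comp hpq
  have h2 : Tendsto (fun n => (p n).2) atTop (𝓝 q.2) := (continuous_snd.tendsto q).comp hpq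
  obtain ⟨ns, hns, hae⟩ := (tendstoInMeasure_of_tendsto_Lp h1).exists_seq_tendsto_ae
  have hall : ∀ᵐ t ∂unitMeasure, ∀ n, (p n).1 t ∈ pairConstraint G :=
    ae_all_iff.2 fun n => (hp n).1
  refine ⟨?_, ?_, ge_of_tendsto' h2 fun n => (hp n).2.2⟩
  · filter_upwards [hae, hall] with t h3 h4
    exact (isClosed_pairConstraint G).mem_of_tendsto h3 (Eventually.of_forall fun n => h4 _)
  · calc ∫⁻ t, cost G (q.1 t) ∂unitMeasure
        ≤ ∫⁻ t, liminf (fun n => cost G ((p (ns n)).1 t)) atTop ∂unitMeasure := by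
          refine lintegral_mono_ae ?_
          filter_upwards [hae] with t h3
          refine ((lowerSemicontinuous_cost G).le_liminf _).trans ?_
          exact liminf_le_liminf_of_le (f := 𝓝 (q.1 t))
            (g := map (fun n => (p (ns n)).1 t) atTop) h3
      _ ≤ liminf (fun n => ∫⁻ t, cost G ((p (ns n)).1 t) ∂unitMeasure) atTop :=
          lintegral_liminf_le fun n => measurable_cost_comp G _
      _ ≤ liminf (fun n => ENNReal.ofReal (p (ns n)).2) atTop :=
          liminf_le_liminf (Eventually.of_forall fun n => (hp (ns n)).2.1)
      _ = ENNReal.ofReal q.2 :=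
          (((ENNReal.continuous_ofReal.tendsto _).comp h2).comp hns.tendsto_atTop).liminf_eq

lemma bounded_actionEpigraph (r : ℝ) : ∃ R, ∀ f, (f, r) ∈ actionEpigraph G → ‖f‖ ≤ R := by
  have htop : 1 + 4 * ENNReal.ofReal r ≠ ∞ := by finiteness
  refine ⟨√(1 + 4 * ENNReal.ofReal r).toReal, fun f hf => Real.le_sqrt_of_sq_le ?_⟩
  rw [Lp.norm_def, ← ENNReal.toReal_pow]
  refine ENNReal.toReal_mono htop ?_
  have h2 := eLpNorm_nnreal_pow_eq_lintegral (f := f) (μ := unitMeasure) (p := 2) two_ne_zero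
  simp only [NNReal.coe_ofNat, ENNReal.coe_ofNat, ENNReal.rpow_ofNat] at h2
  rw [h2]
  calc ∫⁻ t, ‖f t‖ₑ ^ 2 ∂unitMeasure ≤ ∫⁻ t, (1 + 4 * cost G (f t)) ∂unitMeasure := by
        refine lintegral_mono_ae ?_
        filter_upwards [hf.1] with t ht
        rw [← ofReal_norm, ← ENNReal.ofReal_pow (norm_nonneg _)]
        exact ofReal_norm_sq_le_cost G ht
    _ = 1 + 4 * ∫⁻ t, cost G (f t) ∂unitMeasure := by
        rw [lintegral_add_left measurable_const, lintegral_const_mul _ (measurable_cost_comp G f)]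
        simp
    _ ≤ 1 + 4 * ENNReal.ofReal r := by
        gcongr
        exact hf.2.1

end

lemma ofReal_integral_le_lintegral {h : ℝ → ℝ} (hh : Integrable h unitMeasure) :
    ENNReal.ofReal (∫ t, h t ∂unitMeasure) ≤ ∫⁻ t, ENNReal.ofReal (h t) ∂unitMeasure := by
  rw [integral_eq_lintegral_pos_part_sub_lintegral_neg_part hh]
  exact (ENNReal.ofReal_le_ofReal (sub_le_self _ ENNReal.toReal_nonneg)).trans
    ENNReal.ofReal_toReal_le

lemma theta_comm {V : Type*} (ρ : V → ℝ) (i j : V) : theta ρ i j = theta ρ j i := by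
  simp only [theta, add_comm]

section

variable {V : Type*} [Fintype V] (G : SimpleGraph V) [DecidableRel G.Adj]

/-! ### Summation by parts -/

/-- The net outflow `∑_j √ω_ij m_ij + ∑_j ω_ij (σ_j - σ_i) θ_ij(ρ) a` at a node. -/
noncomputable def outflow (ω : V → V → ℝ) (σ : V → ℝ) (a : ℝ) (ρ : V → ℝ) (m : V → V → ℝ) (i : V) :
    ℝ :=
  (∑ j ∈ G.neighborFinset i, √(ω i j) * m i j) +
    (∑ j ∈ G.neighborFinset i, ω i j * (σ j - σ i) * theta ρ i j) * a

lemma sum_neighbor_swap (F : V → V → ℝ) :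
    ∑ i, ∑ j ∈ G.neighborFinset i, F i j = ∑ i, ∑ j ∈ G.neighborFinset i, F j i :=
  Finset.sum_comm' fun i j => by simp [G.adj_comm]

/-- Discrete integration by parts: each edge is counted from both ends, and skewness turns the
second count into -S_j. -/
lemma sum_mul_skew (S : V → ℝ) {F : V → V → ℝ} (hF : ∀ i j, F i j = -F j i) :
    ∑ i, S i * ∑ j ∈ G.neighborFinset i, F i j =
      1 / 2 * ∑ i, ∑ j ∈ G.neighborFinset i, (S i - S j) * F i j := by
  have h := sum_neighbor_swap G fun i j => S i * F i j
  have h2 : ∑ i, ∑ j ∈ G.neighborFinset i, (S i - S j) * F i j =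
      ∑ i, ∑ j ∈ G.neighborFinset i, S i * F i j +
        ∑ i, ∑ j ∈ G.neighborFinset i, S j * F j i := by
    simp only [← Finset.sum_add_distrib]
    refine Finset.sum_congr rfl fun i _ => Finset.sum_congr rfl fun j _ => ?_
    rw [hF i j]
    ring
  rw [h2, ← h]
  simp only [Finset.mul_sum, ← Finset.sum_add_distrib]
  refine Finset.sum_congr rfl fun i _ => Finset.sum_congr rfl fun j _ => ?_
  ring

variable {ω : V → V → ℝ} (σ : V → ℝ)

/-- The duality pairing of a potential with the outflow. -/
lemma sum_mul_sub_outflow (hω_symm : ∀ i j, ω i j = ω j i) (hω_pos : ∀ i j, G.Adj i j → 0 < ω i j)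
    (a : ℝ) (S p ρ : V → ℝ) {m : V → V → ℝ} (hm : ∀ i j, m i j = -m j i) :
    ∑ i, (p i * ρ i - S i * outflow G ω σ a ρ m i) =
      hamiltonJacobi G ω σ a S p ρ +
        1 / 4 * ∑ i, ∑ j ∈ G.neighborFinset i,
          (2 * -grad ω S i j * m i j - (-grad ω S i j) ^ 2 * theta ρ i j) := by
  have h1 := sum_mul_skew G S (F := fun i j => √(ω i j) * m i j) fun i j => by
    rw [hm i j, hω_symm i j]; ring
  have h2 := sum_mul_skew G S (F := fun i j => ω i j * (σ j - σ i) * theta ρ i j) fun i j => by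
    rw [hω_symm i j, theta_comm ρ i j]; ring
  -- The drift carries σ_j - σ_i while `grad` uses the opposite order, hence the sign. Positivity on
  -- edges gives √ω · √ω = ω.
  have h3 : ∑ i, ∑ j ∈ G.neighborFinset i, (S i - S j) * (ω i j * (σ j - σ i) * theta ρ i j) =
      -∑ i, ∑ j ∈ G.neighborFinset i, grad ω σ i j * grad ω S i j * theta ρ i j := by
    simp only [← Finset.sum_neg_distrib]
    refine Finset.sum_congr rfl fun i _ => Finset.sum_congr rfl fun j hj => ?_
    have hsq := Real.mul_self_sqrt (hω_pos i j (by simpa using hj)).le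
    simp only [grad]
    linear_combination (-(S i - S j) * (σ j - σ i) * theta ρ i j) * hsq
  have h4 : ∑ i, S i * outflow G ω σ a ρ m i =
      ∑ i, S i * ∑ j ∈ G.neighborFinset i, √(ω i j) * m i j +
        (∑ i, S i * ∑ j ∈ G.neighborFinset i, ω i j * (σ j - σ i) * theta ρ i j) * a := by
    simp only [outflow]
    rw [Finset.sum_mul, ← Finset.sum_add_distrib]
    refine Finset.sum_congr rfl fun i _ => ?_
    ring
  -- The remainder is the minorant of the edge cost with slope -∇S; its quadratic part cancels the
  -- one in the Hamilton–Jacobi expression.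
  have h5 : ∑ i, ∑ j ∈ G.neighborFinset i,
        (2 * -grad ω S i j * m i j - (-grad ω S i j) ^ 2 * theta ρ i j) =
      -2 * ∑ i, ∑ j ∈ G.neighborFinset i, (S i - S j) * (√(ω i j) * m i j) -
        ∑ i, ∑ j ∈ G.neighborFinset i, grad ω S i j * grad ω S i j * theta ρ i j := by
    simp only [Finset.mul_sum, ← Finset.sum_sub_distrib]
    refine Finset.sum_congr rfl fun i _ => Finset.sum_congr rfl fun j _ => ?_
    simp only [grad]
    ring
  rw [Finset.sum_sub_distrib, h4, h1, h2, h3, h5]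
  simp only [hamiltonJacobi, edgeInner]
  ring

/-! ### Weak duality -/

lemma Feasible.continuousOn {a : ℝ → ℝ} {ρa ρb : V → ℝ} {ρ : ℝ → V → ℝ} {m : ℝ → V → V → ℝ}
    (h : Feasible G ω σ a ρa ρb ρ m) (i : V) : ContinuousOn (fun t => ρ t i) (Icc 0 1) := by
  obtain ⟨g, hg⟩ := h.memH1 i
  exact hg.continuousOn

lemma memLp_sum_mul_flux {m : ℝ → V → V → ℝ} (hm : ∀ i j, MemLp (fun t => m t i j) 2 unitMeasure)
    (i : V) : MemLp (fun t => ∑ j ∈ G.neighborFinset i, √(ω i j) * m t i j) 2 unitMeasure :=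
  memLp_finsetSum _ fun j _ => (hm i j).const_mul _

lemma memLp_drift {a : ℝ → ℝ} (ha : MemLp a ∞ unitMeasure) {ρ : ℝ → V → ℝ}
    (hρ : ∀ i, ContinuousOn (fun t => ρ t i) (Icc 0 1)) (i : V) :
    MemLp (fun t => (∑ j ∈ G.neighborFinset i, ω i j * (σ j - σ i) * theta (ρ t) i j) * a t) 2
      unitMeasure := by
  refine (MemLp.mul_continuousOn ?_ ha).mono_exponent le_top
  unfold theta
  fun_prop

/-- `MemH1` provides only some weak derivative; the continuity equation identifies it. Continuity of
ρ and boundedness of `a` put the drift in L². -/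
lemma Feasible.hasH1Deriv {a : ℝ → ℝ} (ha : MemLp a ∞ unitMeasure) {ρa ρb : V → ℝ}
    {ρ : ℝ → V → ℝ} {m : ℝ → V → V → ℝ} (h : Feasible G ω σ a ρa ρb ρ m) (i : V) :
    HasH1Deriv (fun t => ρ t i) fun t => -outflow G ω σ (a t) (ρ t) (m t) i := by
  have h1 := memLp_sum_mul_flux G (ω := ω) h.memL2 i
  have h2 := memLp_drift G (ω := ω) σ ha (h.continuousOn G σ) i
  refine ⟨(h1.add h2).neg, fun t ht => ?_⟩
  have h0 : (0 : ℝ) ∈ Icc (0 : ℝ) 1 := by simp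
  have h3 := h.continuity_eq i t ht
  simp only [outflow]
  rw [intervalIntegral.integral_neg, intervalIntegral.integral_add
    (intervalIntegrable_of_integrable_unit (MemLp.integrable_unit h1) h0 ht)
    (intervalIntegrable_of_integrable_unit (MemLp.integrable_unit h2) h0 ht)]
  linarith

lemma ofReal_sum_le_cost (ρ : V → ℝ) (m v : V → V → ℝ) :
    ENNReal.ofReal (1 / 4 * ∑ i, ∑ j ∈ G.neighborFinset i,
      (2 * v i j * m i j - v i j ^ 2 * theta ρ i j)) ≤
    4⁻¹ * ∑ i, ∑ j ∈ G.neighborFinset i, edgeCost (theta ρ i j) (m i j) := by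
  rw [ENNReal.ofReal_mul (by norm_num)]
  have : ENNReal.ofReal (1 / 4) = 4⁻¹ := by
    rw [one_div, ENNReal.ofReal_inv_of_pos (by norm_num)]; norm_num
  rw [this]
  gcongr
  refine (Finset.le_sum_of_subadditive _ ENNReal.ofReal_zero.le (fun _ _ => ENNReal.ofReal_add_le)
    _ _).trans (Finset.sum_le_sum fun i _ => ?_)
  refine (Finset.le_sum_of_subadditive _ ENNReal.ofReal_zero.le (fun _ _ => ENNReal.ofReal_add_le)
    _ _).trans (Finset.sum_le_sum fun j _ => ?_)
  exact ofReal_le_edgeCost _ _ _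

/-- Weak duality. -/
theorem Feasible.ofReal_dual_le_action (hω_symm : ∀ i j, ω i j = ω j i) (hω_pos : ∀ i j, G.Adj i j → 0 < ω i j)
    {a : ℝ → ℝ} (ha : MemLp a ∞ unitMeasure) {ρa ρb : V → ℝ}
    {ρ : ℝ → V → ℝ} {m : ℝ → V → V → ℝ} (h : Feasible G ω σ a ρa ρb ρ m) {S S' : ℝ → V → ℝ}
    (hS : DualAdmissible G ω σ a S S') :
    ENNReal.ofReal ((∑ i, S 1 i * ρb i) - ∑ i, S 0 i * ρa i) ≤ action G ρ m := by
  have hint : ∀ i ∈ Finset.univ, Integrable (fun t => S' t i * ρ t i +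
      S t i * -outflow G ω σ (a t) (ρ t) (m t) i) unitMeasure := fun i _ => by
    refine Integrable.add ?_ (MemLp.integrable_unit
      (MemLp.mul_continuousOn (hS.hasH1Deriv i).continuousOn (h.hasH1Deriv G σ ha i).1))
    simp only [mul_comm (S' _ i)]
    exact MemLp.integrable_unit
      (MemLp.mul_continuousOn (h.hasH1Deriv G σ ha i).continuousOn (hS.hasH1Deriv i).1)
  -- The dual objective is the integral of d/dt ⟨S, ρ⟩.
  have hobj : (∑ i, S 1 i * ρb i) - ∑ i, S 0 i * ρa i = ∫ t, ∑ i, (S' t i * ρ t i +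
      S t i * -outflow G ω σ (a t) (ρ t) (m t) i) ∂unitMeasure := by
    rw [integral_finsetSum _ hint, ← Finset.sum_sub_distrib]
    refine Finset.sum_congr rfl fun i _ => ?_
    rw [← h.init, ← h.final]
    exact (hS.hasH1Deriv i).integral_mul (h.hasH1Deriv G σ ha i)
  rw [hobj]
  refine (ofReal_integral_le_lintegral (integrable_finsetSum _ hint)).trans ?_
  refine lintegral_mono_ae ?_
  filter_upwards [hS.sup_eq_zero, h.skew, ae_restrict_mem measurableSet_Icc] with t h1 h2 ht
  refine le_trans (ENNReal.ofReal_le_ofReal ?_) (ofReal_sum_le_cost G (ρ t) (m t)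
    fun i j => -grad ω (S t) i j)
  have h3 := h1.1 (mem_image_of_mem _ (h.mem_simplex t ht))
  have h4 := sum_mul_sub_outflow G σ hω_symm hω_pos (a t) (S t) (S' t) (ρ t) h2
  -- Admissibility makes the Hamilton–Jacobi term nonpositive, leaving only the minorant of the
  -- cost.
  simp only [mul_neg, ← sub_eq_add_neg] at h3 h4 ⊢
  linarith

end

/-! ### The continuity equation as a linear constraint on L² pairs -/

/-- The exceptional times in (0,1) form an open null set, hence none; closedness then covers the
endpoints. -/
lemma mem_of_ae_mem_of_continuousOn {X : Type*} [TopologicalSpace X] {f : ℝ → X} {C : Set X}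
    (hC : IsClosed C) (hf : ContinuousOn f (Icc 0 1)) (h : ∀ᵐ t ∂unitMeasure, f t ∈ C) :
    ∀ t ∈ Icc (0 : ℝ) 1, f t ∈ C := by
  have hcl : IsClosed (Icc (0 : ℝ) 1 ∩ f ⁻¹' C) := hf.preimage_isClosed_of_isClosed isClosed_Icc hC
  have hopen : IsOpen (Ioo (0 : ℝ) 1 ∩ (Icc (0 : ℝ) 1 ∩ f ⁻¹' C)ᶜ) :=
    isOpen_Ioo.inter hcl.isOpen_compl
  have hnull : volume (Ioo (0 : ℝ) 1 ∩ (Icc (0 : ℝ) 1 ∩ f ⁻¹' C)ᶜ) = 0 := by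
    rw [ae_restrict_iff' measurableSet_Icc, ae_iff] at h
    refine measure_mono_null ?_ h
    intro t ht hmem
    exact ht.2 ⟨Ioo_subset_Icc_self ht.1, hmem (Ioo_subset_Icc_self ht.1)⟩
  have hempty := (hopen.measure_eq_zero_iff volume).1 hnull
  have hsub : Ioo (0 : ℝ) 1 ⊆ Icc (0 : ℝ) 1 ∩ f ⁻¹' C := fun t ht => by
    by_contra hnot
    exact (hempty ▸ (⟨ht, hnot⟩ : t ∈ Ioo (0 : ℝ) 1 ∩ (Icc (0 : ℝ) 1 ∩ f ⁻¹' C)ᶜ) : t ∈ (∅ : Set ℝ))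
  intro t ht
  rw [← closure_Ioo zero_ne_one] at ht
  exact (closure_minimal hsub hcl ht).2

section

variable {V : Type*} [Fintype V] (G : SimpleGraph V) [DecidableRel G.Adj]

/-- The node part of a pair, as a continuous linear functional. -/
noncomputable def massCLM (i : V) : PairSpace V →L[ℝ] ℝ := EuclideanSpace.proj (Sum.inl i)

/-- The divergence of the edge part of a pair, as a continuous linear functional. -/
noncomputable def fluxCLM (ω : V → V → ℝ) (i : V) : PairSpace V →L[ℝ] ℝ :=
  ∑ j ∈ G.neighborFinset i, √(ω i j) • EuclideanSpace.proj (Sum.inr (i, j))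

/-- The drift of the node part of a pair, as a continuous linear functional. -/
noncomputable def driftCLM (ω : V → V → ℝ) (σ : V → ℝ) (i : V) : PairSpace V →L[ℝ] ℝ :=
  ∑ j ∈ G.neighborFinset i, (ω i j * (σ j - σ i) / 2) • (massCLM i + massCLM j)

lemma fluxCLM_add_driftCLM (ω : V → V → ℝ) (σ : V → ℝ) (a : ℝ) (z : PairSpace V) (i : V) :
    fluxCLM G ω i z + a * driftCLM G ω σ i z = outflow G ω σ a (mass z) (flux z) i := by
  unfold outflow fluxCLM driftCLM
  rw [mul_comm a]
  congr 1
  · simp [flux]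
  · simp only [_root_.sum_apply]
    congr 1
    refine Finset.sum_congr rfl fun j _ => ?_
    have hmass : ∀ k, massCLM k z = mass z k := fun _ => rfl
    rw [_root_.smul_apply, _root_.add_apply, smul_eq_mul, hmass, hmass, theta]
    ring

variable (ω : V → V → ℝ) (σ : V → ℝ) {a : ℝ → ℝ} (ha : MemLp a ∞ unitMeasure)

/-- The outflow at a node, as an operator on `L²` pairs. -/
noncomputable def outflowOp (i : V) : Lp (PairSpace V) 2 unitMeasure →L[ℝ] Lp ℝ 2 unitMeasure :=
  (fluxCLM G ω i).compLpL 2 unitMeasure +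
    (mulBounded a ha).comp ((driftCLM G ω σ i).compLpL 2 unitMeasure)

lemma coeFn_outflowOp (i : V) (f : Lp (PairSpace V) 2 unitMeasure) :
    outflowOp G ω σ ha i f =ᵐ[unitMeasure]
      fun t => outflow G ω σ (a t) (mass (f t)) (flux (f t)) i := by
  have h : outflowOp G ω σ ha i f = (fluxCLM G ω i).compLpL 2 unitMeasure f +
    mulBounded a ha ((driftCLM G ω σ i).compLpL 2 unitMeasure f) := rfl
  rw [h]
  filter_upwards [Lp.coeFn_add ((fluxCLM G ω i).compLpL 2 unitMeasure f)
      (mulBounded a ha ((driftCLM G ω σ i).compLpL 2 unitMeasure f)),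
    coeFn_mulBounded a ha ((driftCLM G ω σ i).compLpL 2 unitMeasure f),
    ContinuousLinearMap.coeFn_compLpL (p := 2) (fluxCLM G ω i) f,
    ContinuousLinearMap.coeFn_compLpL (p := 2) (driftCLM G ω σ i) f] with t h1 h2 h3 h4
  rw [h1, Pi.add_apply, h2, h3, h4, fluxCLM_add_driftCLM]

/-- The linear operator of the integrated continuity equation: `ρ_i + ∫₀ᵗ outflow_i` for all `t`
and the total outflow. -/
noncomputable def constraintOp :
    Lp (PairSpace V) 2 unitMeasure →L[ℝ] (V → Lp ℝ 2 unitMeasure) × (V → ℝ) :=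
  (ContinuousLinearMap.pi fun i =>
    (massCLM i).compLpL 2 unitMeasure + volterra.comp (outflowOp G ω σ ha i)).prod
  (ContinuousLinearMap.pi fun i =>
    (integralTo 1 (right_mem_Icc.2 zero_le_one)).comp (outflowOp G ω σ ha i))

/-- The right-hand side of the integrated continuity equation. -/
noncomputable def constraintRhs (ρa ρb : V → ℝ) : (V → Lp ℝ 2 unitMeasure) × (V → ℝ) :=
  (fun i => Lp.const 2 unitMeasure (ρa i), fun i => ρa i - ρb i)

lemma coeFn_constraintOp_fst (f : Lp (PairSpace V) 2 unitMeasure) (i : V) :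
    (constraintOp G ω σ ha f).1 i =ᵐ[unitMeasure]
      fun t => mass (f t) i + ∫ s in (0 : ℝ)..t, outflowOp G ω σ ha i f s := by
  have h : (constraintOp G ω σ ha f).1 i =
    (massCLM i).compLpL 2 unitMeasure f + volterra (outflowOp G ω σ ha i f) := rfl
  rw [h]
  filter_upwards [Lp.coeFn_add ((massCLM i).compLpL 2 unitMeasure f)
      (volterra (outflowOp G ω σ ha i f)), coeFn_volterra (outflowOp G ω σ ha i f),
    ContinuousLinearMap.coeFn_compLpL (p := 2) (massCLM i) f] with t h1 h2 h3
  rw [h1, Pi.add_apply, h2, h3]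
  rfl

lemma constraintOp_snd (f : Lp (PairSpace V) 2 unitMeasure) (i : V) :
    (constraintOp G ω σ ha f).2 i = ∫ s in (0 : ℝ)..1, outflowOp G ω σ ha i f s :=
  rfl

lemma memLp_flux (f : Lp (PairSpace V) 2 unitMeasure) (i j : V) :
    MemLp (fun t => flux (f t) i j) 2 unitMeasure :=
  (Lp.memLp f).eval_piLp (Sum.inr (i, j))

/-- A point of the epigraph satisfying the linear constraint is a feasible pair. -/
theorem exists_feasible_of_constraintOp_eq {ρa ρb : V → ℝ} {f : Lp (PairSpace V) 2 unitMeasure}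
    (hf : ∀ᵐ t ∂unitMeasure, f t ∈ pairConstraint G)
    (hT : constraintOp G ω σ ha f = constraintRhs ρa ρb) :
    ∃ ρ m, Feasible G ω σ a ρa ρb ρ m ∧ action G ρ m = ∫⁻ t, cost G (f t) ∂unitMeasure := by
  have h0 : (0 : ℝ) ∈ Icc (0 : ℝ) 1 := by simp
  -- An L² class has no pointwise values, so the curve is defined by the integrated equation; the
  -- first component of the constraint says that it agrees a.e. with the mass of `f`.
  let ρ : ℝ → V → ℝ := fun t i => ρa i + ∫ s in (0 : ℝ)..t, (-outflowOp G ω σ ha i f) s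
  have hH1 : ∀ i, HasH1Deriv (fun t => ρ t i) (-outflowOp G ω σ ha i f : Lp ℝ 2 unitMeasure) :=
    fun i => HasH1Deriv.of_integral _ (Lp.memLp _)
  have hneg : ∀ i, ∀ t ∈ Icc (0 : ℝ) 1,
      ρ t i = ρa i - ∫ s in (0 : ℝ)..t, outflowOp G ω σ ha i f s := fun i t ht => by
    have := (integralTo t ht).map_neg (outflowOp G ω σ ha i f)
    simp only [integralTo_apply] at this
    simp only [ρ]
    rw [this, sub_eq_add_neg]
  have hmass : ∀ᵐ t ∂unitMeasure, ρ t = mass (f t) := by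
    have hall : ∀ᵐ t ∂unitMeasure, ∀ i, ρ t i = mass (f t) i := by
      refine ae_all_iff.2 fun i => ?_
      have hi : (constraintOp G ω σ ha f).1 i = Lp.const 2 unitMeasure (ρa i) := by rw [hT]; rfl
      filter_upwards [coeFn_constraintOp_fst G ω σ ha f i,
        Lp.coeFn_const (p := 2) (μ := unitMeasure) (ρa i),
        ae_restrict_mem measurableSet_Icc] with t h1 h2 h3
      rw [hi, h2] at h1
      rw [hneg i t h3, sub_eq_iff_eq_add]
      exact h1
    filter_upwards [hall] with t ht using funext ht
  have hcont : ContinuousOn ρ (Icc 0 1) := continuousOn_pi.2 fun i => (hH1 i).continuousOn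
  have hm := memLp_flux f
  refine ⟨ρ, fun t => flux (f t), ⟨fun i => ⟨_, hH1 i⟩, ?_, hm, ?_, ?_, ?_, ?_⟩, ?_⟩
  · refine mem_of_ae_mem_of_continuousOn (isClosed_stdSimplex ℝ V) hcont ?_
    filter_upwards [hf, hmass] with t h1 h2
    rw [h2]
    exact h1.1
  · filter_upwards [hf] with t h1 using h1.2.1
  · ext i
    simp [ρ]
  · ext i
    -- The a.e. identity says nothing about the terminal value; this is the role of the second
    -- component.
    rw [hneg i 1 (by simp), ← constraintOp_snd, hT]
    simp [constraintRhs]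
  · intro i t ht
    have h1 := memLp_sum_mul_flux G (ω := ω) hm i
    have h2 := memLp_drift G (ω := ω) σ ha (ρ := ρ) (fun i => (hH1 i).continuousOn) i
    rw [add_assoc, ← intervalIntegral.integral_add
      (intervalIntegrable_of_integrable_unit (MemLp.integrable_unit h1) h0 ht)
      (intervalIntegrable_of_integrable_unit (MemLp.integrable_unit h2) h0 ht),
      hneg i t ht, hneg i 0 h0, intervalIntegral.integral_same,
      intervalIntegral_congr_unit (coeFn_outflowOp G ω σ ha i f) ht]
    have h3 : ∫ s in (0 : ℝ)..t, outflow G ω σ (a s) (mass (f s)) (flux (f s)) i =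
        ∫ s in (0 : ℝ)..t, outflow G ω σ (a s) (ρ s) (flux (f s)) i := by
      refine intervalIntegral_congr_unit ?_ ht
      filter_upwards [hmass] with s hs
      rw [hs]
    rw [h3]
    simp only [outflow]
    ring
  · refine lintegral_congr_ae ?_
    filter_upwards [hmass] with t ht
    rw [ht]
    rfl

lemma memLp_toPair {ρ : ℝ → V → ℝ} {m : ℝ → V → V → ℝ}
    (hρ : ∀ i, MemLp (fun t => ρ t i) 2 unitMeasure)
    (hm : ∀ i j, MemLp (fun t => m t i j) 2 unitMeasure) :
    MemLp (fun t => toPair (ρ t) (m t)) 2 unitMeasure := by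
  refine MemLp.of_eval_piLp fun k => ?_
  rcases k with i | ⟨i, j⟩
  · exact hρ i
  · exact hm i j

end

/-! ### Fluxes with prescribed divergence -/

section

variable {V : Type*} [Fintype V] (G : SimpleGraph V) [DecidableRel G.Adj] (ω : V → V → ℝ)

/-- The node functions that are divergences of skew-symmetric edge functions of the graph. -/
def divergences : Submodule ℝ (V → ℝ) where
  carrier := {b | ∃ M : V → V → ℝ, (∀ i j, M i j = -M j i) ∧ (∀ i j, ¬ G.Adj i j → M i j = 0) ∧
    ∀ i, ∑ j ∈ G.neighborFinset i, √(ω i j) * M i j = b i}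
  add_mem' := by
    rintro b c ⟨M, h1, h2, h3⟩ ⟨N, k1, k2, k3⟩
    refine ⟨M + N, fun i j => ?_, fun i j hij => ?_, fun i => ?_⟩
    · simp only [Pi.add_apply, h1 i j, k1 i j]
      ring
    · simp [h2 i j hij, k2 i j hij]
    · simp only [Pi.add_apply, mul_add, Finset.sum_add_distrib, h3, k3]
  zero_mem' := ⟨0, by simp, by simp, by simp⟩
  smul_mem' := by
    rintro c b ⟨M, h1, h2, h3⟩
    refine ⟨c • M, fun i j => ?_, fun i j hij => ?_, fun i => ?_⟩
    · simp only [Pi.smul_apply, smul_eq_mul, h1 i j]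
      ring
    · simp [h2 i j hij]
    · simp only [Pi.smul_apply, smul_eq_mul, mul_left_comm _ c, ← Finset.mul_sum, h3]

variable {ω}

-- Send the flux 1/√ω_kl from k to l along the edge.
open Classical in
lemma single_sub_single_mem_divergences_of_adj (hω_symm : ∀ i j, ω i j = ω j i)
    (hω_pos : ∀ i j, G.Adj i j → 0 < ω i j) {k l : V} (hkl : G.Adj k l) :
    (Pi.single k 1 - Pi.single l 1 : V → ℝ) ∈ divergences G ω := by
  have hne : k ≠ l := hkl.ne
  have hsq : √(ω k l) ≠ 0 := (Real.sqrt_pos.2 (hω_pos k l hkl)).ne'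
  refine ⟨fun i j => (√(ω k l))⁻¹ * ((if i = k ∧ j = l then 1 else 0) -
    (if i = l ∧ j = k then 1 else 0)), fun i j => ?_, fun i j hij => ?_, fun i => ?_⟩
  · simp only [and_comm (a := j = k), and_comm (a := j = l)]
    ring
  · have h1 : ¬ (i = k ∧ j = l) := fun h => hij (h.1 ▸ h.2 ▸ hkl)
    have h2 : ¬ (i = l ∧ j = k) := fun h => hij (h.1 ▸ h.2 ▸ hkl.symm)
    simp [h1, h2]
  · rcases eq_or_ne i k with rfl | hik
    · rw [Finset.sum_eq_single l]
      · simp [hne, hsq]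
      · intro j _ hj
        simp [hj, hne]
      · intro h
        exact absurd hkl (by simpa using h)
    · rcases eq_or_ne i l with rfl | hil
      · rw [Finset.sum_eq_single k]
        · simp [hne, hne.symm, hω_symm i k, hsq]
        · intro j _ hj
          simp [hj, hne.symm]
        · intro h
          exact absurd hkl.symm (by simpa using h)
      · simp [hik, hil]

/-- On a connected graph every node function of zero sum is a divergence. -/
theorem mem_divergences (hG : G.Connected) (hω_symm : ∀ i j, ω i j = ω j i)
    (hω_pos : ∀ i j, G.Adj i j → 0 < ω i j) {b : V → ℝ} (hb : ∑ i, b i = 0) :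
    b ∈ divergences G ω := by
  classical
  obtain ⟨k⟩ := hG.nonempty
  have hpath : ∀ i, (Pi.single i 1 - Pi.single k 1 : V → ℝ) ∈ divergences G ω := by
    intro i
    obtain ⟨w⟩ := hG.preconnected i k
    induction w with
    | nil => simp
    | cons h _ ih =>
      have := add_mem (single_sub_single_mem_divergences_of_adj G hω_symm hω_pos h) ih
      simpa using this
  -- The zero sum cancels the contributions at the base node `k`.
  have hsum : b = ∑ i, b i • (Pi.single i 1 - Pi.single k 1 : V → ℝ) := by
    simp only [smul_sub, Finset.sum_sub_distrib, ← Finset.sum_smul, hb, zero_smul, sub_zero]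
    exact pi_eq_sum_univ' b
  rw [hsum]
  exact sum_mem fun i _ => Submodule.smul_mem _ _ (hpath i)

end

/-! ### A feasible pair of finite action -/

lemma hasH1Deriv_of_hasDerivAt {f f' : ℝ → ℝ} (h : ∀ t, HasDerivAt f (f' t) t)
    (hf' : Continuous f') : HasH1Deriv f f' := by
  refine ⟨memLp_of_continuousOn hf'.continuousOn, fun t _ => ?_⟩
  rw [intervalIntegral.integral_eq_sub_of_hasDerivAt (fun s _ => h s)
    (hf'.intervalIntegrable _ _)]
  ring

/-- This is (u + v)² ≤ 2u² + 2v² divided by x, with x ≥ κ s² compensating the factor s² of the first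
term. It is carried out on the supremum form of the cost, half of k²x going to each term, so that x
= 0 needs no separate treatment. -/
lemma edgeCost_le_of_le {x s q w κ α : ℝ} (hκ : 0 < κ) (hx : κ * s ^ 2 ≤ x) (hx1 : x ≤ 1) :
    edgeCost x (s * q - w * x * α) ≤ ENNReal.ofReal (2 * q ^ 2 / κ + 2 * (w ^ 2 * α ^ 2)) := by
  have hx0 : 0 ≤ x := le_trans (by positivity) hx
  rw [edgeCost_eq_iSup]
  refine iSup_le fun k => ENNReal.ofReal_le_ofReal ?_
  have h1 : 2 * k * (s * q) ≤ κ * s ^ 2 * (k ^ 2 / 2) + 2 * q ^ 2 / κ := by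
    rw [← sub_le_iff_le_add', le_div_iff₀ hκ]
    nlinarith [sq_nonneg (κ * s * k - 2 * q)]
  have h2 : -(2 * k * (w * x * α)) ≤ x * (k ^ 2 / 2) + x * (2 * (w ^ 2 * α ^ 2)) := by
    nlinarith [mul_nonneg hx0 (sq_nonneg (k + 2 * (w * α)))]
  have h3 : κ * s ^ 2 * (k ^ 2 / 2) ≤ x * (k ^ 2 / 2) := by gcongr
  have h4 : x * (2 * (w ^ 2 * α ^ 2)) ≤ 1 * (2 * (w ^ 2 * α ^ 2)) := by gcongr
  linarith

section

variable {V : Type*} [Fintype V] (G : SimpleGraph V) [DecidableRel G.Adj]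
variable (ω : V → V → ℝ) (σ : V → ℝ) {a : ℝ → ℝ} (ha : MemLp a ∞ unitMeasure)

lemma constraintOp_toLp {ρ : ℝ → V → ℝ} {m : ℝ → V → V → ℝ}
    (hρ : ∀ i, HasH1Deriv (fun t => ρ t i) fun t => -outflow G ω σ (a t) (ρ t) (m t) i)
    (hf : MemLp (fun t => toPair (ρ t) (m t)) 2 unitMeasure) :
    constraintOp G ω σ ha hf.toLp = constraintRhs (ρ 0) (ρ 1) := by
  have hint : ∀ i, ∀ t ∈ Icc (0 : ℝ) 1,
      ∫ s in (0 : ℝ)..t, outflowOp G ω σ ha i hf.toLp s = ρ 0 i - ρ t i := by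
    intro i t ht
    have h1 : outflowOp G ω σ ha i hf.toLp =ᵐ[unitMeasure]
        fun t => outflow G ω σ (a t) (ρ t) (m t) i := by
      filter_upwards [coeFn_outflowOp G ω σ ha i hf.toLp, hf.coeFn_toLp] with s h1 h2
      rw [h1, h2]
      rfl
    have h2 := (hρ i).2 t ht
    rw [intervalIntegral.integral_neg] at h2
    rw [intervalIntegral_congr_unit h1 ht]
    linarith
  refine Prod.ext (funext fun i => Lp.ext ?_) (funext fun i => ?_)
  · filter_upwards [coeFn_constraintOp_fst G ω σ ha hf.toLp i, hf.coeFn_toLp,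
      Lp.coeFn_const (p := 2) (μ := unitMeasure) (ρ 0 i),
      ae_restrict_mem measurableSet_Icc] with t h1 h2 h3 h4
    rw [h1, h2, hint i t h4]
    refine Eq.trans ?_ h3.symm
    simp
  · rw [constraintOp_snd, hint i 1 (by simp)]
    rfl

/-- Interpolate from ρa to ρb while mixing in the uniform density with weight (t(1-t))². The density
is then at least κ (t(1-t))² and its velocity has a factor t(1-t), so velocity squared over density
stays bounded up to the endpoints. A further flux proportional to θ cancels the noise drift at
finite cost. -/
theorem exists_mem_actionEpigraph (hG : G.Connected) (hω_symm : ∀ i j, ω i j = ω j i)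
    (hω_pos : ∀ i j, G.Adj i j → 0 < ω i j) {ρa ρb : V → ℝ} (hρa : ρa ∈ stdSimplex ℝ V)
    (hρb : ρb ∈ stdSimplex ℝ V) :
    ∃ f r, (f, r) ∈ actionEpigraph G ∧ constraintOp G ω σ ha f = constraintRhs ρa ρb := by
  have := hG.nonempty
  let κ : ℝ := (Fintype.card V : ℝ)⁻¹
  have hκ : 0 < κ := inv_pos.2 (Nat.cast_pos.2 Fintype.card_pos)
  have hκsum : ∑ _i : V, κ = 1 := by simp [κ]
  obtain ⟨M, hM1, hM2, hM3⟩ := mem_divergences G hG hω_symm hω_pos (b := fun i => ρa i - κ)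
    (by rw [Finset.sum_sub_distrib, hρa.2, hκsum, sub_self])
  obtain ⟨N, hN1, hN2, hN3⟩ := mem_divergences G hG hω_symm hω_pos (b := fun i => ρa i - ρb i)
    (by rw [Finset.sum_sub_distrib, hρa.2, hρb.2, sub_self])
  -- β runs from 0 to 1 with β' = 6t(1-t). Below, t(1-t) g is the derivative of γ and t(1-t) h that
  -- of (1-γ) β.
  let β : ℝ → ℝ := fun t => 3 * t ^ 2 - 2 * t ^ 3
  let γ : ℝ → ℝ := fun t => (t * (1 - t)) ^ 2
  let g : ℝ → ℝ := fun t => 2 * (1 - 2 * t)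
  let h : ℝ → ℝ := fun t => 6 * (1 - γ t) - g t * β t
  let ρ : ℝ → V → ℝ := fun t i => ρa i + γ t * (κ - ρa i) + (1 - γ t) * β t * (ρb i - ρa i)
  let q : ℝ → V → V → ℝ := fun t i j => g t * M i j + h t * N i j
  let w : V → V → ℝ := fun i j => if G.Adj i j then √(ω i j) * (σ j - σ i) else 0
  let m : ℝ → V → V → ℝ := fun t i j => t * (1 - t) * q t i j - w i j * theta (ρ t) i j * a t
  have hderiv : ∀ i t, HasDerivAt (fun t => ρ t i)
      (t * (1 - t) * (g t * (κ - ρa i) + h t * (ρb i - ρa i))) t := by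
    intro i t
    have hβ : HasDerivAt β (3 * (2 * t) - 2 * (3 * t ^ 2)) t := by
      exact (((hasDerivAt_pow 2 t).const_mul 3).sub
        ((hasDerivAt_pow 3 t).const_mul 2)).congr_deriv (by norm_num)
    have hγ : HasDerivAt γ (2 * (t * (1 - t)) * (1 * (1 - t) + t * (-1))) t := by
      exact (((hasDerivAt_id t).mul ((hasDerivAt_id t).const_sub 1)).pow 2).congr_deriv (by simp)
    refine (((hγ.mul_const (κ - ρa i)).const_add (ρa i)).add
      (((hγ.const_sub 1).mul hβ).mul_const (ρb i - ρa i))).congr_deriv ?_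
    simp only [h, g, γ, β]
    ring
  have hρcont : ∀ i, Continuous fun t => ρ t i := fun i => by fun_prop
  have hmass : ∀ t ∈ Icc (0 : ℝ) 1, ρ t ∈ stdSimplex ℝ V ∧ ∀ i, κ * (t * (1 - t)) ^ 2 ≤ ρ t i := by
    rintro t ⟨h0, h1⟩
    have hs : 0 ≤ t * (1 - t) := mul_nonneg h0 (by linarith)
    have hs1 : t * (1 - t) ≤ 1 := by nlinarith
    have hγ1 : 0 ≤ 1 - γ t := by
      have : γ t ≤ 1 := pow_le_one₀ hs hs1
      linarith
    have hβ0 : 0 ≤ β t := by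
      have : β t = t ^ 2 * (3 - 2 * t) := by simp only [β]; ring
      rw [this]
      exact mul_nonneg (sq_nonneg t) (by linarith)
    have hβ1 : 0 ≤ 1 - β t := by
      have : 1 - β t = (1 - t) ^ 2 * (1 + 2 * t) := by simp only [β]; ring
      rw [this]
      exact mul_nonneg (sq_nonneg _) (by linarith)
    have hexp : ∀ i, ρ t i =
        κ * (t * (1 - t)) ^ 2 + (1 - γ t) * ((1 - β t) * ρa i + β t * ρb i) := fun i => by
      simp only [ρ, γ]; ring
    have hlow : ∀ i, κ * (t * (1 - t)) ^ 2 ≤ ρ t i := fun i => by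
      rw [hexp]
      exact le_add_of_nonneg_right (mul_nonneg hγ1 (add_nonneg (mul_nonneg hβ1 (hρa.1 i))
        (mul_nonneg hβ0 (hρb.1 i))))
    refine ⟨⟨fun i => le_trans (by positivity) (hlow i), ?_⟩, hlow⟩
    simp only [ρ, Finset.sum_add_distrib, ← Finset.mul_sum, Finset.sum_sub_distrib, hρa.2, hρb.2,
      hκsum]
    ring
  have hout : ∀ t i, -outflow G ω σ (a t) (ρ t) (m t) i =
      t * (1 - t) * (g t * (κ - ρa i) + h t * (ρb i - ρa i)) := by
    intro t i
    have h1 : ∑ j ∈ G.neighborFinset i, √(ω i j) * m t i j =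
        t * (1 - t) * (g t * ∑ j ∈ G.neighborFinset i, √(ω i j) * M i j +
          h t * ∑ j ∈ G.neighborFinset i, √(ω i j) * N i j) -
        (∑ j ∈ G.neighborFinset i, ω i j * (σ j - σ i) * theta (ρ t) i j) * a t := by
      simp only [Finset.mul_sum, Finset.sum_mul, ← Finset.sum_add_distrib,
        ← Finset.sum_sub_distrib]
      refine Finset.sum_congr rfl fun j hj => ?_
      have hij : G.Adj i j := by simpa using hj
      have hsq := Real.mul_self_sqrt (hω_pos i j hij).le
      simp only [m, q, w, if_pos hij]
      linear_combination (-(σ j - σ i) * theta (ρ t) i j * a t) * hsq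
    rw [outflow, h1, hM3, hN3]
    ring
  have hH1 : ∀ i, HasH1Deriv (fun t => ρ t i) fun t => -outflow G ω σ (a t) (ρ t) (m t) i := by
    intro i
    simp only [hout]
    exact hasH1Deriv_of_hasDerivAt (hderiv i) (by fun_prop)
  have hm : ∀ i j, MemLp (fun t => m t i j) 2 unitMeasure := by
    intro i j
    refine (memLp_of_continuousOn (Continuous.continuousOn (by fun_prop))).sub
      ((MemLp.mul_continuousOn (Continuous.continuousOn ?_) ha).mono_exponent le_top)
    unfold theta
    fun_prop
  have hf := memLp_toPair (fun i => (hH1 i).memLp) hm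
  let B : ℝ → ℝ := fun t => ∑ i, ∑ j ∈ G.neighborFinset i,
    (2 * q t i j ^ 2 / κ + 2 * (w i j ^ 2 * a t ^ 2))
  have hB : Integrable B unitMeasure := by
    refine integrable_finsetSum _ fun i _ => integrable_finsetSum _ fun j _ => ?_
    refine Integrable.add ?_ (((ha.mono_exponent le_top).integrable_sq.const_mul _).const_mul _)
    exact MemLp.integrable_unit (memLp_of_continuousOn (Continuous.continuousOn (by fun_prop)))
  have hfin : ∫⁻ t, cost G ((MemLp.toLp _ hf : Lp (PairSpace V) 2 unitMeasure) t) ∂unitMeasure ≠ ∞ := by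
    refine ((lintegral_mono_ae (g := fun t => 4⁻¹ * ENNReal.ofReal (B t)) ?_).trans_lt ?_).ne
    · filter_upwards [hf.coeFn_toLp, ae_restrict_mem measurableSet_Icc] with t h1 h2
      rw [h1]
      unfold cost
      gcongr
      simp only [B]
      rw [ENNReal.ofReal_sum_of_nonneg fun i _ => by positivity]
      refine Finset.sum_le_sum fun i _ => ?_
      rw [ENNReal.ofReal_sum_of_nonneg fun j _ => by positivity]
      refine Finset.sum_le_sum fun j _ => edgeCost_le_of_le hκ ?_ (theta_le_one (hmass t h2).1 i j)
      have h3 := (hmass t h2).2 i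
      have h4 := (hmass t h2).2 j
      simp only [mass_toPair, theta]
      linarith
    · rw [lintegral_const_mul' _ _ (by simp)]
      exact ENNReal.mul_lt_top (by simp) hB.lintegral_lt_top
  refine ⟨hf.toLp, _, ⟨?_, (ENNReal.ofReal_toReal hfin).ge, ENNReal.toReal_nonneg⟩, ?_⟩
  · filter_upwards [hf.coeFn_toLp, ae_restrict_mem measurableSet_Icc] with t h1 h2
    rw [h1]
    refine ⟨(hmass t h2).1, fun i j => ?_, fun i j hij => ?_⟩
    · have hw : w i j = -w j i := by
        simp only [w, G.adj_comm j i, hω_symm j i]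
        split_ifs <;> ring
      simp only [flux_toPair, m, q, hM1 i j, hN1 i j, hw, theta_comm (ρ t) i j]
      ring
    · simp [m, q, w, hij, hM2 i j hij, hN2 i j hij]
  · rw [constraintOp_toLp G ω σ ha hH1 hf]
    congr 1 <;> · ext i; simp [ρ, β, γ]; try ring

end

/-! ### The Hamilton--Jacobi expression as a linear function of the density -/

lemma memLp_theta {V : Type*} {ρ : ℝ → V → ℝ} (hρ : ∀ i, MemLp (fun t => ρ t i) ∞ unitMeasure) (i j : V) :
    MemLp (fun t => theta (ρ t) i j) ∞ unitMeasure := by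
  have h : (fun t => theta (ρ t) i j) = fun t => (1 / 2 : ℝ) * (ρ t i + ρ t j) := by
    ext t
    simp only [theta]
    ring
  rw [h]
  exact ((hρ i).add (hρ j)).const_mul _

section

variable {V : Type*} [Fintype V] (G : SimpleGraph V) [DecidableRel G.Adj]
variable (ω : V → V → ℝ) (σ : V → ℝ)

lemma edgeInner_combo (b c : ℝ) (ρ η : V → ℝ) (u v : V → V → ℝ) :
    edgeInner G (b • ρ + c • η) u v = b * edgeInner G ρ u v + c * edgeInner G η u v := by
  simp only [edgeInner, Finset.mul_sum, ← Finset.sum_add_distrib]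
  refine Finset.sum_congr rfl fun i _ => Finset.sum_congr rfl fun j _ => ?_
  simp only [theta, Pi.add_apply, Pi.smul_apply, smul_eq_mul]
  ring

lemma hamiltonJacobi_combo (a : ℝ) (S p : V → ℝ) (b c : ℝ) (ρ η : V → ℝ) :
    hamiltonJacobi G ω σ a S p (b • ρ + c • η) =
      b * hamiltonJacobi G ω σ a S p ρ + c * hamiltonJacobi G ω σ a S p η := by
  have h : ∑ i, p i * (b • ρ + c • η) i = b * ∑ i, p i * ρ i + c * ∑ i, p i * η i := by
    simp only [Finset.mul_sum, ← Finset.sum_add_distrib]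
    refine Finset.sum_congr rfl fun i _ => ?_
    simp only [Pi.add_apply, Pi.smul_apply, smul_eq_mul]
    ring
  simp only [hamiltonJacobi, edgeInner_combo, h]
  ring

/-- The Hamilton--Jacobi expression as a linear map in the density. -/
noncomputable def hamiltonJacobiLinear (a : ℝ) (S p : V → ℝ) : (V → ℝ) →ₗ[ℝ] ℝ where
  toFun := hamiltonJacobi G ω σ a S p
  map_add' ρ η := by simpa using hamiltonJacobi_combo G ω σ a S p 1 1 ρ η
  map_smul' c ρ := by simpa using hamiltonJacobi_combo G ω σ a S p c 0 ρ 0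

open Classical in
lemma hamiltonJacobi_eq_sum (a : ℝ) (S p ρ : V → ℝ) :
    hamiltonJacobi G ω σ a S p ρ =
      ∑ i, hamiltonJacobi G ω σ a S p (Pi.single i 1) * ρ i := by
  have h := (hamiltonJacobiLinear G ω σ a S p).pi_apply_eq_sum_univ ρ
  refine h.trans (Finset.sum_congr rfl fun i _ => ?_)
  have hi : (fun j => if i = j then 1 else 0 : V → ℝ) = Pi.single i 1 := by
    ext j
    simp [Pi.single_apply, eq_comm]
  rw [smul_eq_mul, mul_comm, hi]
  rfl

/-- Gradients ignore constants and densities have mass one. This freedom is used to normalise the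
supremum to 0. -/
lemma hamiltonJacobi_sub_const (a b c : ℝ) (S p : V → ℝ) {ρ : V → ℝ} (hρ : ρ ∈ stdSimplex ℝ V) :
    hamiltonJacobi G ω σ a (fun i => S i - b) (fun i => p i - c) ρ =
      hamiltonJacobi G ω σ a S p ρ - c := by
  have h : ∑ i, (p i - c) * ρ i = ∑ i, p i * ρ i - c := by
    simp only [sub_mul, Finset.sum_sub_distrib, ← Finset.mul_sum, hρ.2, mul_one]
  have hg : grad ω (fun i => S i - b) = grad ω S := by
    ext i j
    simp only [grad]
    ring
  simp only [hamiltonJacobi, h, hg]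
  ring

lemma dualAdmissible_sub {a : ℝ → ℝ} {S p : ℝ → V → ℝ} {μ : ℝ → ℝ}
    (hS : ∀ i, HasH1Deriv (fun t => S t i) fun t => p t i) (hμ : MemLp μ 2 unitMeasure)
    (hle : ∀ᵐ t ∂unitMeasure, ∀ η ∈ stdSimplex ℝ V,
      hamiltonJacobi G ω σ (a t) (S t) (p t) η ≤ μ t)
    (heq : ∀ᵐ t ∂unitMeasure, ∃ η ∈ stdSimplex ℝ V,
      hamiltonJacobi G ω σ (a t) (S t) (p t) η = μ t) :
    DualAdmissible G ω σ a (fun t i => S t i - ∫ s in (0 : ℝ)..t, μ s)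
      (fun t i => p t i - μ t) := by
  refine ⟨fun i => ?_, ?_⟩
  · have h := (hS i).add (HasH1Deriv.of_integral 0 hμ.neg)
    simpa [intervalIntegral.integral_neg, ← sub_eq_add_neg] using h
  · filter_upwards [hle, heq] with t h1 ⟨η, h2, h3⟩
    refine ⟨?_, fun b hb => ?_⟩
    · rintro _ ⟨ζ, hζ, rfl⟩
      beta_reduce
      rw [hamiltonJacobi_sub_const G ω σ _ _ _ _ _ hζ]
      linarith [h1 ζ hζ]
    · have := hb (mem_image_of_mem _ h2)
      rwa [hamiltonJacobi_sub_const G ω σ _ _ _ _ _ h2, h3, sub_self] at this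

/-! ### Measurable maximisers -/

/-- Induction over the vertices of the simplex: switch to the next vertex on the measurable set of
times where it beats the current value. -/
lemma exists_measurable_sum_ge [Nonempty V] {c : V → ℝ → ℝ} (hc : ∀ i, Measurable (c i)) :
    ∃ ρ : ℝ → V → ℝ, (∀ i, Measurable fun t => ρ t i) ∧ (∀ t, ρ t ∈ stdSimplex ℝ V) ∧
      ∀ t i, c i t ≤ ∑ j, c j t * ρ t j := by
  classical
  suffices h : ∀ s : Finset V, ∃ ρ : ℝ → V → ℝ, (∀ i, Measurable fun t => ρ t i) ∧
      (∀ t, ρ t ∈ stdSimplex ℝ V) ∧ ∀ t, ∀ i ∈ s, c i t ≤ ∑ j, c j t * ρ t j by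
    obtain ⟨ρ, h1, h2, h3⟩ := h Finset.univ
    exact ⟨ρ, h1, h2, fun t i => h3 t i (Finset.mem_univ i)⟩
  intro s
  induction s using Finset.induction_on with
  | empty =>
    obtain ⟨k⟩ := ‹Nonempty V›
    exact ⟨fun _ => Pi.single k 1, fun i => measurable_const, fun _ => single_mem_stdSimplex ℝ k,
      by simp⟩
  | insert k s _ ih =>
    obtain ⟨ρ, h1, h2, h3⟩ := ih
    have hset : MeasurableSet {t | c k t ≤ ∑ j, c j t * ρ t j} :=
      measurableSet_le (hc k) (Finset.measurable_sum _ fun j _ => (hc j).mul (h1 j))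
    refine ⟨fun t => if c k t ≤ ∑ j, c j t * ρ t j then ρ t else Pi.single k 1, fun i => ?_,
      fun t => ?_, fun t i hi => ?_⟩
    · have : (fun t => (if c k t ≤ ∑ j, c j t * ρ t j then ρ t else Pi.single k 1) i) =
          fun t => if c k t ≤ ∑ j, c j t * ρ t j then ρ t i else (Pi.single k 1 : V → ℝ) i := by
        ext t
        split_ifs <;> rfl
      rw [this]
      exact Measurable.ite hset (h1 i) measurable_const
    · beta_reduce
      split_ifs
      · exact h2 t
      · exact single_mem_stdSimplex ℝ k
    · beta_reduce
      rcases Finset.mem_insert.1 hi with rfl | hi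
      · split_ifs with h
        · exact h
        · simp [Pi.single_apply]
      · split_ifs with h
        · exact h3 t i hi
        · refine (h3 t i hi).trans ((not_le.1 h).le.trans ?_)
          simp [Pi.single_apply]

/-- A linear function on the simplex is at most its largest vertex value, so a density that beats
every vertex is a maximiser. The vertex values are replaced by measurable versions before selecting.
-/
lemma exists_measurable_maximizer [Nonempty V] {a : ℝ → ℝ} (ha : AEMeasurable a unitMeasure)
    {S p : ℝ → V → ℝ} (hS : ∀ i, AEMeasurable (fun t => S t i) unitMeasure)
    (hp : ∀ i, AEMeasurable (fun t => p t i) unitMeasure) :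
    ∃ ρ : ℝ → V → ℝ, (∀ i, Measurable fun t => ρ t i) ∧ (∀ t, ρ t ∈ stdSimplex ℝ V) ∧
      ∀ᵐ t ∂unitMeasure, ∀ η ∈ stdSimplex ℝ V,
        hamiltonJacobi G ω σ (a t) (S t) (p t) η ≤
          hamiltonJacobi G ω σ (a t) (S t) (p t) (ρ t) := by
  classical
  have hc : ∀ i, AEMeasurable (fun t => hamiltonJacobi G ω σ (a t) (S t) (p t) (Pi.single i 1))
      unitMeasure := fun i => by
    unfold hamiltonJacobi edgeInner grad
    fun_prop
  obtain ⟨ρ, h1, h2, h3⟩ := exists_measurable_sum_ge fun i => (hc i).measurable_mk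
  refine ⟨ρ, h1, h2, ?_⟩
  filter_upwards [ae_all_iff.2 fun i => (hc i).ae_eq_mk] with t ht η hη
  rw [hamiltonJacobi_eq_sum G ω σ _ _ _ η, hamiltonJacobi_eq_sum G ω σ _ _ _ (ρ t)]
  simp only [ht]
  calc _ ≤ ∑ i, (∑ j, (hc j).mk _ t * ρ t j) * η i :=
        Finset.sum_le_sum fun i _ => mul_le_mul_of_nonneg_right (h3 t i) (hη.1 i)
    _ = _ := by rw [← Finset.mul_sum, hη.2, mul_one]

/-! ### The dual value of a functional -/

-- Riesz representation in each L² component. The sign is chosen so that `q i` becomes the time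
-- derivative of the dual potential and `s i` its terminal value.
open Classical in
lemma exists_repr_functional (φ : (V → Lp ℝ 2 unitMeasure) × (V → ℝ) →L[ℝ] ℝ) :
    ∃ (q : V → Lp ℝ 2 unitMeasure) (s : V → ℝ), ∀ k,
      φ k = ∑ i, (-(∫ t, q i t * k.1 i t ∂unitMeasure) + s i * k.2 i) := by
  let ψ : V → (Lp ℝ 2 unitMeasure →L[ℝ] ℝ) := fun i => φ.comp
    ((ContinuousLinearMap.inl ℝ (V → Lp ℝ 2 unitMeasure) (V → ℝ)).comp
      (ContinuousLinearMap.single ℝ (fun _ : V => Lp ℝ 2 unitMeasure) i))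
  refine ⟨fun i => -(InnerProductSpace.toDual ℝ _).symm (ψ i), fun i => φ (0, Pi.single i 1),
    fun k => ?_⟩
  have hk : k = ∑ i, ((Pi.single i (k.1 i), 0) + k.2 i • (0, Pi.single i 1) :
      (V → Lp ℝ 2 unitMeasure) × (V → ℝ)) := by
    rw [Finset.sum_add_distrib]
    refine Prod.ext ?_ ?_
    · simp [Prod.fst_sum, Finset.univ_sum_single]
    · simp only [Prod.snd_add, Prod.snd_sum, Prod.smul_snd]
      simpa using pi_eq_sum_univ' k.2
  conv_lhs => rw [hk]
  rw [map_sum]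
  refine Finset.sum_congr rfl fun i _ => ?_
  rw [map_add, map_smul, smul_eq_mul, mul_comm (k.2 i)]
  congr 1
  have h1 : φ (Pi.single i (k.1 i), 0) = ψ i (k.1 i) := rfl
  rw [h1, ← InnerProductSpace.toDual_symm_apply, L2.inner_def, ← integral_neg]
  refine integral_congr_ae ?_
  filter_upwards [Lp.coeFn_neg ((InnerProductSpace.toDual ℝ _).symm (ψ i))] with t ht
  rw [ht]
  simp [mul_comm]

variable {a : ℝ → ℝ} (ha : MemLp a ∞ unitMeasure)

/-- Integration by parts moves the derivative p = S' from S onto the running integral of the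
outflow. The boundary term cancels against the second component because S(1) = s. -/
lemma repr_functional_constraint (p : Lp ℝ 2 unitMeasure) (s : ℝ) {S : ℝ → ℝ}
    (hS : HasH1Deriv S p) (hS1 : S 1 = s) (ρa ρb : V → ℝ) (f : Lp (PairSpace V) 2 unitMeasure)
    (i : V) (hmass : MemLp (fun t => mass (f t) i) 2 unitMeasure) :
    -(∫ t, p t * (constraintOp G ω σ ha f - constraintRhs ρa ρb).1 i t ∂unitMeasure) +
      s * (constraintOp G ω σ ha f - constraintRhs ρa ρb).2 i =
    S 1 * ρb i - S 0 * ρa i - ∫ t, (p t * mass (f t) i -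
      S t * outflow G ω σ (a t) (mass (f t)) (flux (f t)) i) ∂unitMeasure := by
  let O := outflowOp G ω σ ha i f
  have hp := Lp.memLp p
  have hO : HasH1Deriv (fun t => 0 + ∫ s in (0 : ℝ)..t, O s) O :=
    HasH1Deriv.of_integral 0 (Lp.memLp O)
  have hparts := hS.integral_mul hO
  have hi1 : Integrable (fun t => p t * mass (f t) i) unitMeasure := hp.integrable_mul hmass
  have hi2 : Integrable (fun t => p t * (0 + ∫ s in (0 : ℝ)..t, O s)) unitMeasure :=
    hp.integrable_mul (hO.memLp (p := 2))
  have hi3 : Integrable (fun t => p t * ρa i) unitMeasure :=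
    (MemLp.integrable_unit hp).mul_const _
  have hi4 : Integrable (fun t => S t * O t) unitMeasure :=
    MemLp.integrable_unit (MemLp.mul_continuousOn hS.continuousOn (Lp.memLp O))
  have h1 : ∫ t, p t * (constraintOp G ω σ ha f - constraintRhs ρa ρb).1 i t ∂unitMeasure =
      ∫ t, (p t * mass (f t) i + p t * (0 + ∫ s in (0 : ℝ)..t, O s) - p t * ρa i)
        ∂unitMeasure := by
    refine integral_congr_ae ?_
    filter_upwards [Lp.coeFn_sub ((constraintOp G ω σ ha f).1 i)
        (Lp.const 2 unitMeasure (ρa i)), coeFn_constraintOp_fst G ω σ ha f i,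
      Lp.coeFn_const (p := 2) (μ := unitMeasure) (ρa i)] with t h1 h2 h3
    have h4 : (constraintOp G ω σ ha f - constraintRhs ρa ρb).1 i =
      (constraintOp G ω σ ha f).1 i - Lp.const 2 unitMeasure (ρa i) := rfl
    simp only [h4, h1, Pi.sub_apply, h2, h3, Function.const_apply]
    simp only [O]
    ring
  have h2 : (constraintOp G ω σ ha f - constraintRhs ρa ρb).2 i =
      (∫ s in (0 : ℝ)..1, O s) - (ρa i - ρb i) := rfl
  have h3 : ∫ t, (p t * mass (f t) i -
      S t * outflow G ω σ (a t) (mass (f t)) (flux (f t)) i) ∂unitMeasure =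
      ∫ t, (p t * mass (f t) i - S t * O t) ∂unitMeasure := by
    refine integral_congr_ae ?_
    filter_upwards [coeFn_outflowOp G ω σ ha i f] with t ht
    simp only [O, ht]
  have h4 : ∫ t, p t * ρa i ∂unitMeasure = (S 1 - S 0) * ρa i := by
    rw [integral_mul_const, ← integral_unit, hS.2 1 (by simp)]
    ring
  rw [integral_add hi2 hi4, intervalIntegral.integral_same] at hparts
  have hi12 : Integrable (fun t => p t * mass (f t) i + p t * (0 + ∫ s in (0 : ℝ)..t, O s))
    unitMeasure := hi1.add hi2
  rw [h1, integral_sub hi12 hi3, integral_add hi1 hi2, h2, h3, integral_sub hi1 hi4, h4, ← hS1]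
  linear_combination hparts

lemma memLp_const_mul_edge_sum {F : V → V → ℝ → ℝ} {q : ℝ≥0∞} (b : ℝ)
    (hF : ∀ i j, MemLp (F i j) q unitMeasure) :
    MemLp (fun t => b * ∑ i, ∑ j ∈ G.neighborFinset i, F i j t) q unitMeasure := by
  have h1 : ∀ i, MemLp (fun t => ∑ j ∈ G.neighborFinset i, F i j t) q unitMeasure := fun i =>
    memLp_finsetSum _ fun j _ => hF i j
  have h2 : MemLp (fun t => ∑ i, ∑ j ∈ G.neighborFinset i, F i j t) q unitMeasure :=
    memLp_finsetSum _ fun i _ => h1 i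
  exact h2.const_mul b

lemma memLp_edgeInner {ρ : ℝ → V → ℝ} (hρ : ∀ i, MemLp (fun t => ρ t i) ∞ unitMeasure)
    {u v : ℝ → V → V → ℝ} (hu : ∀ i j, MemLp (fun t => u t i j) ∞ unitMeasure)
    (hv : ∀ i j, MemLp (fun t => v t i j) ∞ unitMeasure) :
    MemLp (fun t => edgeInner G (ρ t) (u t) (v t)) ∞ unitMeasure := by
  have h : ∀ i j, MemLp (fun t => u t i j * v t i j * theta (ρ t) i j) ∞ unitMeasure :=
    fun i j => memLp_mul_bounded (memLp_mul_bounded (hu i j) (hv i j)) (memLp_theta hρ i j)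
  exact memLp_const_mul_edge_sum G (1 / 2) h

lemma memLp_hamiltonJacobi (ha : MemLp a ∞ unitMeasure) {ρ : ℝ → V → ℝ} (hρ : ∀ i, MemLp (fun t => ρ t i) ∞ unitMeasure)
    {S p : ℝ → V → ℝ} (hS : ∀ i j, MemLp (fun t => grad ω (S t) i j) ∞ unitMeasure)
    (hp : ∀ i, MemLp (fun t => p t i) 2 unitMeasure) :
    MemLp (fun t => hamiltonJacobi G ω σ (a t) (S t) (p t) (ρ t)) 2 unitMeasure := by
  have h1 : ∀ i, MemLp (fun t => p t i * ρ t i) 2 unitMeasure := fun i => by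
    simp only [mul_comm (p _ i)]
    exact memLp_mul_bounded (hρ i) (hp i)
  have h2 : MemLp (fun t => ∑ i, p t i * ρ t i) 2 unitMeasure := memLp_finsetSum _ fun i _ => h1 i
  have h3 : MemLp (fun t => 1 / 2 * edgeInner G (ρ t) (grad ω (S t)) (grad ω (S t))) 2
      unitMeasure := ((memLp_edgeInner G hρ hS hS).mono_exponent le_top).const_mul _
  have h4 : MemLp (fun t => edgeInner G (ρ t) (grad ω σ) (grad ω (S t)) * a t) 2 unitMeasure :=
    (memLp_mul_bounded (memLp_edgeInner G hρ (u := fun _ => grad ω σ)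
      (fun i j => memLp_const _) hS) ha).mono_exponent le_top
  exact (h2.add h3).add h4

/-- Every continuous functional of the constraint has a Lagrangian value below any upper bound of
the dual problem. -/
theorem exists_lagrangian_le [Nonempty V] (hω_symm : ∀ i j, ω i j = ω j i)
    (hω_pos : ∀ i j, G.Adj i j → 0 < ω i j) (ρa ρb : V → ℝ) {D : ℝ}
    (hD : ∀ S S', DualAdmissible G ω σ a S S' →
      (∑ i, S 1 i * ρb i) - ∑ i, S 0 i * ρa i ≤ D)
    (hρb : ρb ∈ stdSimplex ℝ V)
    (φ : (V → Lp ℝ 2 unitMeasure) × (V → ℝ) →L[ℝ] ℝ) :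
    ∃ f r, (f, r) ∈ actionEpigraph G ∧
      r + φ (constraintOp G ω σ ha f - constraintRhs ρa ρb) ≤ D := by
  obtain ⟨p, s, hφ⟩ := exists_repr_functional φ
  let S : ℝ → V → ℝ := fun t i =>
    (s i - ∫ x in (0 : ℝ)..1, p i x) + ∫ x in (0 : ℝ)..t, p i x
  have hS : ∀ i, HasH1Deriv (fun t => S t i) (p i) := fun i =>
    HasH1Deriv.of_integral _ (Lp.memLp _)
  have hS1 : ∀ i, S 1 i = s i := fun i => by simp [S]
  obtain ⟨ρ, hρ1, hρ2, hρ3⟩ := exists_measurable_maximizer G ω σ (a := a) (S := S)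
    (p := fun t i => p i t) ha.1.aemeasurable
    (fun i => ((hS i).memLp (p := 2)).1.aemeasurable) (fun i => (Lp.memLp (p i)).1.aemeasurable)
  have hρL : ∀ i, MemLp (fun t => ρ t i) ∞ unitMeasure := fun i =>
    memLp_top_of_bound (hρ1 i).aestronglyMeasurable 1 (ae_of_all _ fun t => by
      rw [Real.norm_of_nonneg ((hρ2 t).1 i)]
      exact le_one_of_mem_stdSimplex (hρ2 t) i)
  let v : ℝ → V → V → ℝ := fun t => grad ω (S t)
  have hvL : ∀ i j, MemLp (fun t => v t i j) ∞ unitMeasure := fun i j =>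
    ((hS i).memLp.sub (hS j).memLp).const_mul _
  -- This flux attains equality in the edgewise bound with slope -∇S, so that it minimises the
  -- Lagrangian for the given density.
  let m : ℝ → V → V → ℝ := fun t i j => if G.Adj i j then -v t i j * theta (ρ t) i j else 0
  have hmskew : ∀ t i j, m t i j = -m t j i := fun t i j => by
    simp only [m, G.adj_comm j i, theta_comm (ρ t) j i, v, grad, hω_symm j i]
    split_ifs <;> ring
  have hmL : ∀ i j, MemLp (fun t => m t i j) 2 unitMeasure := fun i j => by
    by_cases hij : G.Adj i j
    · simp only [m, if_pos hij]
      exact (memLp_mul_bounded (hvL i j).neg (memLp_theta hρL i j)).mono_exponent le_top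
    · simp only [m, if_neg hij]
      exact memLp_const 0
  have hf := memLp_toPair (fun i => (hρL i).mono_exponent le_top) hmL
  let f : Lp (PairSpace V) 2 unitMeasure := hf.toLp
  have hfae : ∀ᵐ t ∂unitMeasure, f t = toPair (ρ t) (m t) := hf.coeFn_toLp
  let R : ℝ → ℝ := fun t => 1 / 4 * ∑ i, ∑ j ∈ G.neighborFinset i,
    (-v t i j) ^ 2 * theta (ρ t) i j
  have hR0 : ∀ t, 0 ≤ R t := fun t => mul_nonneg (by norm_num) (Finset.sum_nonneg fun i _ =>
    Finset.sum_nonneg fun j _ => mul_nonneg (sq_nonneg _) (theta_nonneg (hρ2 t) i j))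
  have hRL : MemLp R ∞ unitMeasure := by
    have h : ∀ i j, MemLp (fun t => (-v t i j) ^ 2 * theta (ρ t) i j) ∞ unitMeasure :=
      fun i j => by
        simp only [sq]
        exact memLp_mul_bounded (memLp_mul_bounded (hvL i j).neg (hvL i j).neg) (memLp_theta hρL i j)
    exact memLp_const_mul_edge_sum G (1 / 4) h
  let μ : ℝ → ℝ := fun t => hamiltonJacobi G ω σ (a t) (S t) (fun i => p i t) (ρ t)
  have hμ : MemLp μ 2 unitMeasure :=
    memLp_hamiltonJacobi G ω σ ha hρL hvL fun i => Lp.memLp (p i)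
  have hadm := dualAdmissible_sub G ω σ hS hμ hρ3 (ae_of_all _ fun t => ⟨ρ t, hρ2 t, rfl⟩)
  have hcost : ∫⁻ t, cost G (f t) ∂unitMeasure = ENNReal.ofReal (∫ t, R t ∂unitMeasure) := by
    rw [ofReal_integral_eq_lintegral_ofReal (MemLp.integrable_unit (hRL.mono_exponent le_top))
      (ae_of_all _ hR0)]
    refine lintegral_congr_ae ?_
    filter_upwards [hfae] with t ht
    have h4 : ENNReal.ofReal (1 / 4) = 4⁻¹ := by
      rw [one_div, ENNReal.ofReal_inv_of_pos (by norm_num)]; norm_num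
    have hn : ∀ i j, 0 ≤ (-v t i j) ^ 2 * theta (ρ t) i j := fun i j =>
      mul_nonneg (sq_nonneg _) (theta_nonneg (hρ2 t) i j)
    rw [ht, ENNReal.ofReal_mul (by norm_num), h4, ENNReal.ofReal_sum_of_nonneg fun i _ =>
      Finset.sum_nonneg fun j _ => hn i j]
    unfold cost
    congr 1
    refine Finset.sum_congr rfl fun i _ => ?_
    rw [ENNReal.ofReal_sum_of_nonneg fun j _ => hn i j]
    refine Finset.sum_congr rfl fun j hj => ?_
    have hij : G.Adj i j := by simpa using hj
    simp only [mass_toPair, flux_toPair, m, if_pos hij]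
    exact edgeCost_self_mul (theta_nonneg (hρ2 t) i j) _
  refine ⟨f, ∫ t, R t ∂unitMeasure, ⟨?_, hcost.le, integral_nonneg hR0⟩, ?_⟩
  · filter_upwards [hfae] with t ht
    rw [ht]
    exact ⟨hρ2 t, hmskew t, fun i j hij => by simp [m, hij]⟩
  · have hmassL : ∀ i, MemLp (fun t => mass (f t) i) 2 unitMeasure := fun i =>
      (Lp.memLp f).eval_piLp (Sum.inl i)
    have hsum : φ (constraintOp G ω σ ha f - constraintRhs ρa ρb) =
        (∑ i, S 1 i * ρb i) - ∑ i, S 0 i * ρa i - ∫ t, (μ t + R t) ∂unitMeasure := by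
      rw [hφ, ← Finset.sum_sub_distrib]
      simp only [repr_functional_constraint G ω σ ha (p _) (s _) (hS _) (hS1 _) ρa ρb f _
        (hmassL _)]
      rw [Finset.sum_sub_distrib]
      congr 1
      rw [← integral_finsetSum]
      · refine integral_congr_ae ?_
        filter_upwards [hfae] with t ht
        have h := sum_mul_sub_outflow G σ hω_symm hω_pos (a t) (S t) (fun i => p i t) (ρ t)
          (hmskew t)
        simp only [ht, mass_toPair, flux_toPair]
        rw [h]
        simp only [μ, R]
        congr 2
        refine Finset.sum_congr rfl fun i _ => Finset.sum_congr rfl fun j hj => ?_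
        have hij : G.Adj i j := by simpa using hj
        simp only [m, if_pos hij, v]
        ring
      · intro i _
        refine ((Lp.memLp (p i)).integrable_mul (hmassL i)).sub ?_
        have h1 := MemLp.integrable_unit
          (MemLp.mul_continuousOn (hS i).continuousOn (Lp.memLp (outflowOp G ω σ ha i f)))
        refine h1.congr ?_
        filter_upwards [coeFn_outflowOp G ω σ ha i f] with t ht
        rw [ht]
    -- The shift by ∫₀ᵗ μ vanishes at 0 and ρb has mass one, so the dual value drops by exactly ∫ μ.
    -- The cost ∫ R cancels the same term in `hsum`.
    have hle := hD _ _ hadm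
    simp only [intervalIntegral.integral_same, sub_zero, sub_mul, Finset.sum_sub_distrib,
      ← Finset.mul_sum, hρb.2, mul_one, integral_unit] at hle
    rw [hsum, integral_add (MemLp.integrable_unit hμ)
      (MemLp.integrable_unit (hRL.mono_exponent le_top))]
    linarith

end

/-! ### Strong duality and the Wong–Zakai path -/

/-- On [0,1] the grid index is at most ⌊1/δ⌋, so only finitely many slopes occur. -/
lemma memLp_wongZakaiDeriv (w : ℝ≥0 → ℝ) (δ : ℝ≥0) :
    MemLp (wongZakaiDeriv w δ) ∞ unitMeasure := by
  let F : ℕ → ℝ := fun n => (w ((n + 1) * δ) - w (n * δ)) / δ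
  have hF : wongZakaiDeriv w δ = fun t : ℝ => F ⌊t / (δ : ℝ)⌋₊ := rfl
  have hmeas : Measurable (wongZakaiDeriv w δ) := by
    rw [hF]
    exact (measurable_from_top (f := F)).comp (Nat.measurable_floor.comp (measurable_id.div_const _))
  refine memLp_top_of_bound hmeas.aestronglyMeasurable
    (∑ n ∈ Finset.range (⌊1 / (δ : ℝ)⌋₊ + 1), ‖F n‖) ?_
  filter_upwards [ae_restrict_mem measurableSet_Icc] with t ht
  rw [hF]
  refine Finset.single_le_sum (f := fun n => ‖F n‖) (fun n _ => norm_nonneg _)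
    (Finset.mem_range.2 (Nat.lt_succ_of_le (Nat.floor_mono ?_)))
  have := ht.2
  gcongr

/-- Strong duality with a bounded driving signal. -/
theorem exists_isLeast_action_isLUB_dual {V : Type*} [Fintype V] (G : SimpleGraph V)
    [DecidableRel G.Adj] (hG : G.Connected) {ω : V → V → ℝ} (hω_symm : ∀ i j, ω i j = ω j i)
    (hω_pos : ∀ i j, G.Adj i j → 0 < ω i j) (σ : V → ℝ) {a : ℝ → ℝ}
    (ha : MemLp a ∞ unitMeasure) {ρa ρb : V → ℝ} (hρa : ρa ∈ stdSimplex ℝ V)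
    (hρb : ρb ∈ stdSimplex ℝ V) :
    ∃ c : ℝ≥0,
      IsLeast {A : ℝ≥0∞ | ∃ ρ m, Feasible G ω σ a ρa ρb ρ m ∧ A = action G ρ m} (c : ℝ≥0∞) ∧
      IsLUB {r : ℝ | ∃ S S' : ℝ → V → ℝ, DualAdmissible G ω σ a S S' ∧
          r = (∑ i, S 1 i * ρb i) - ∑ i, S 0 i * ρa i} (c : ℝ) := by
  have := hG.nonempty
  set dual := {r : ℝ | ∃ S S' : ℝ → V → ℝ, DualAdmissible G ω σ a S S' ∧
    r = (∑ i, S 1 i * ρb i) - ∑ i, S 0 i * ρa i}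
  obtain ⟨f₀, r₀, hf₀, hT₀⟩ := exists_mem_actionEpigraph G ω σ ha hG hω_symm hω_pos hρa hρb
  have hbdd : BddAbove dual := by
    obtain ⟨ρ, m, hfeas, hact⟩ := exists_feasible_of_constraintOp_eq G ω σ ha hf₀.1 hT₀
    refine ⟨r₀, ?_⟩
    rintro _ ⟨S, S', hS, rfl⟩
    have h := hfeas.ofReal_dual_le_action G σ hω_symm hω_pos ha hS
    rw [hact] at h
    exact (ENNReal.ofReal_le_ofReal_iff hf₀.2.2).1 (h.trans hf₀.2.1)
  -- The zero potential shows that the dual set is nonempty and D ≥ 0, so D can be read as a value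
  -- of the nonnegative action.
  have hzero : (0 : ℝ) ∈ dual := by
    have h0 : ∀ (b : ℝ) (η : V → ℝ), hamiltonJacobi G ω σ b 0 0 η = 0 := fun b η => by
      simp [hamiltonJacobi, edgeInner, grad]
    refine ⟨0, 0, ⟨fun i => ⟨MemLp.zero, by simp⟩, ae_of_all _ fun t => ?_⟩, by simp⟩
    simp only [Pi.zero_apply, h0]
    rw [Nonempty.image_const ⟨ρa, hρa⟩]
    exact isLUB_singleton
  have hlub := isLUB_csSup ⟨0, hzero⟩ hbdd
  set D := sSup dual
  have hD0 : 0 ≤ D := hlub.1 hzero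
  obtain ⟨f, hT, hf⟩ := exists_mem_epigraph_of_dual_le (actionEpigraph G)
    (isClosed_actionEpigraph G) (convex_actionEpigraph G)
    (fun f r s h hrs => ⟨h.1, h.2.1.trans (ENNReal.ofReal_le_ofReal hrs), h.2.2.trans hrs⟩)
    (bounded_actionEpigraph G) (constraintOp G ω σ ha) (constraintRhs ρa ρb) D
    ⟨f₀, r₀, hf₀, hT₀⟩
    (exists_lagrangian_le G ω σ ha hω_symm hω_pos ρa ρb
      (fun S S' hS => hlub.1 ⟨S, S', hS, rfl⟩) hρb)
  obtain ⟨ρ, m, hfeas, hact⟩ := exists_feasible_of_constraintOp_eq G ω σ ha hf.1 hT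
  have hge : ∀ ρ m, Feasible G ω σ a ρa ρb ρ m → ENNReal.ofReal D ≤ action G ρ m := by
    intro ρ m h
    rcases eq_or_ne (action G ρ m) ∞ with htop | htop
    · simp [htop]
    refine ENNReal.ofReal_le_of_le_toReal (hlub.2 ?_)
    rintro _ ⟨S, S', hS, rfl⟩
    exact (ENNReal.ofReal_le_iff_le_toReal htop).1
      (h.ofReal_dual_le_action G σ hω_symm hω_pos ha hS)
  refine ⟨D.toNNReal, ⟨⟨ρ, m, hfeas, ?_⟩, ?_⟩, ?_⟩
  · exact le_antisymm (hge ρ m hfeas) (hact ▸ hf.2.1)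
  · rintro _ ⟨ρ, m, h, rfl⟩
    exact hge ρ m h
  · rwa [Real.coe_toNNReal D hD0]

end GraphOT

theorem mainTheorem4 {V : Type*} [Fintype V] (G : SimpleGraph V) [DecidableRel G.Adj]
    (hG : G.Connected)
    (ω : V → V → ℝ) (hω_symm : ∀ i j, ω i j = ω j i) (hω_pos : ∀ i j, G.Adj i j → 0 < ω i j)
    (σ : V → ℝ)
    {Ω : Type*} [MeasurableSpace Ω] (P : Measure Ω) [IsProbabilityMeasure P]
    (W : ℝ≥0 → Ω → ℝ) (hW : IsBrownianReal W P)
    (δ : ℝ≥0) (hδ : 0 < δ)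
    (ρa ρb : V → ℝ) (hρa : ρa ∈ stdSimplex ℝ V) (hρb : ρb ∈ stdSimplex ℝ V) (x : Ω) :
    ∃ c : ℝ≥0,
      IsLeast {A : ℝ≥0∞ | ∃ ρ m,
        GraphOT.Feasible G ω σ (GraphOT.wongZakaiDeriv (fun t => W t x) δ) ρa ρb ρ m ∧
          A = GraphOT.action G ρ m} (c : ℝ≥0∞) ∧
      IsLUB {r : ℝ | ∃ S S' : ℝ → V → ℝ,
        GraphOT.DualAdmissible G ω σ (GraphOT.wongZakaiDeriv (fun t => W t x) δ) S S' ∧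
          r = (∑ i, S 1 i * ρb i) - ∑ i, S 0 i * ρa i} (c : ℝ) :=
  GraphOT.exists_isLeast_action_isLUB_dual G hG hω_symm hω_pos σ
    (GraphOT.memLp_wongZakaiDeriv _ δ) hρa hρb
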